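/- **Setting.** Let $M$ be an $N$-dimensional differentiable manifold with a Riemannian metric tensor $a_{mn}(x)$, and let $3\le r\le\infty$. Let $F=F(x,y)$ be a Finsler metric function on $M$ of class $C^{r+1}$ in $y$: for each $x\in M$, $F(x,\cdot)$ is defined on an open cone $\mathcal D_x\subseteq T_xM\setminus\{0\}$ of admissible vectors (possibly all of $T_xM\setminus\{0\}$), is positive, positively homogeneous of degree $1$ and of class $C^{r+1}$ there, and its metric tensor $g_{mn}(x,y)=\frac12\,\partial^2F^2/\partial y^m\partial y^n$ is positive definite on $\mathcal D_x$. The indicatrix at $x$ is the hypersurface $\mathcal I_x=\{y\in\mathcal D_x : F(x,y)=1\}$ with the Riemannian metric induced by $g_{mn}(x,\cdot)$. For local parameters $u^a$ ($a=1,\dots,N-1$) of $\mathcal I_x$ of class $C^{r+1}$, $y=l(u)$, the induced metric is $i_{ab}=g_{mn}\,\frac{\partial l^m}{\partial u^a}\frac{\partial l^n}{\partial u^b}$, with Christoffel symbols $i_a{}^c{}_b$ and curvature tensor $I_a{}^c{}_{bd}=\partial_d\, i_a{}^c{}_b-\partial_b\, i_a{}^c{}_d+i_a{}^e{}_b\,i_e{}^c{}_d-i_a{}^e{}_d\,i_e{}^c{}_b$.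 The indicatrix is a space of constant curvature $\mathcal C$ if $i_{ce}I_a{}^e{}_{bd}=-\mathcal C\,(i_{cb}i_{ad}-i_{cd}i_{ab})$ in all such parameters, with $\mathcal C$ independent of $y$. **Theorem 2.4.** Suppose that the indicatrix supported by a point $x\in M$ is a space of constant curvature $\mathcal C>0$. Then the following hold at the point $x$. 1. The tangent space is conformally flat, the conformal factor being a power of $F$: for all constants $c_1>0$ and $c_2$ with $$(1+c_2)^2=\mathcal C ,$$ the metric tensor $k_{ij}=\bigl(c_1F^{c_2}\bigr)^2g_{ij}$ on $\mathcal D_x$ has identically vanishing Riemann curvature tensor. 2. The tangent space with its Finslerian metric tensor is (locally) conformally isomorphic to the Euclidean space $(T_xM,a_{mn}(x))$. With $h=\sqrt{\mathcal C}$, every $y_0\in\mathcal D_x$ has an open conical neighbourhood $V\subseteq\mathcal D_x$ and a diffeomorphism $y\mapsto\zeta(x,y)$ of $V$ onto an open subset of $T_xM$, of class $C^r$ together with its inverse, such that $$g_{mn}(x,y)=\varkappa^2\,\frac{\partial\zeta^i}{\partial y^m}\frac{\partial\zeta^j}{\partial y^n}\,a_{ij}(x),\qquad \varkappa=\frac1h\,F(x,y)^{1-h},$$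 $\zeta(x,\gamma y)=\gamma^h\zeta(x,y)$ for $\gamma>0$, and $F(x,y)=1$ if and only if $a_{ij}(x)\zeta^i\zeta^j=1$. -/

import Mathlib

open scoped Manifold ContDiff

noncomputable section

namespace Finsleroid

/-- The coordinate model `ℝⁿ` of an `n`-dimensional manifold and of each of its tangent spaces. -/
abbrev Vec (n : ℕ) : Type := EuclideanSpace ℝ (Fin n)

/-- The partial derivative `∂f/∂yⁱ` at `y`. -/
def pd {n : ℕ} (f : Vec n → ℝ) (i : Fin n) (y : Vec n) : ℝ :=
  fderiv ℝ f y (EuclideanSpace.single i 1)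

/-! ### Riemannian metrics in coordinates -/

/-- The Christoffel symbols
`Γᵏᵢⱼ = (1/2) gᵏᵉ (∂ᵢ gₑⱼ + ∂ⱼ gₑᵢ - ∂ₑ gᵢⱼ)` of a metric tensor `g` given in coordinates;
the upper index comes first. -/
def christoffel {n : ℕ} (g : Vec n → Matrix (Fin n) (Fin n) ℝ) (k i j : Fin n) (y : Vec n) : ℝ :=
  (1 / 2) * ∑ e, (g y)⁻¹ k e *
    (pd (fun z => g z e j) i y + pd (fun z => g z e i) j y - pd (fun z => g z i j) e y)

/-- The curvature tensor
`Lᵢᵏₘⱼ = ∂ₘ Γᵏᵢⱼ - ∂ⱼ Γᵏᵢₘ + Γᵗᵢⱼ Γᵏₜₘ - Γᵗᵢₘ Γᵏₜⱼ` of a metric tensor given in coordinates. -/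
def curvature {n : ℕ} (g : Vec n → Matrix (Fin n) (Fin n) ℝ) (y : Vec n) (i k m j : Fin n) : ℝ :=
  pd (christoffel g k i j) m y - pd (christoffel g k i m) j y
    + ∑ t, (christoffel g t i j y * christoffel g k t m y
      - christoffel g t i m y * christoffel g k t j y)

/-! ### Finsler spaces -/

/-- The Finslerian metric tensor `gᵢⱼ(y) = (1/2) ∂²F²/∂yⁱ∂yʲ` in a fixed tangent space. -/
def metricTensor {n : ℕ} (F : Vec n → ℝ) (y : Vec n) : Matrix (Fin n) (Fin n) ℝ :=
  Matrix.of fun i j => (1 / 2) * pd (pd (fun z => F z ^ 2) j) i y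

/-- `F` is a Finsler metric function of class `C^s` in a fixed tangent space, with domain `D`:
an open cone of nonzero vectors (all of them, or only the directions in which `F` is regular);
there `F` is positive, positively homogeneous of degree one, of class `C^s`, and strongly convex,
i.e. its metric tensor is positive definite. -/
structure IsFinslerMetricFunction {n : ℕ} (s : WithTop ℕ∞) (D : Set (Vec n)) (F : Vec n → ℝ) :
    Prop where
  isOpen : IsOpen D
  zero_notMem : (0 : Vec n) ∉ D
  smul_mem : ∀ y ∈ D, ∀ c : ℝ, 0 < c → c • y ∈ D
  pos : ∀ y ∈ D, 0 < F y
  homogeneous : ∀ y ∈ D, ∀ c : ℝ, 0 < c → F (c • y) = c * F y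
  contDiffOn : ContDiffOn ℝ s F D
  posDef : ∀ y ∈ D, (metricTensor F y).PosDef

/-- A Finsler space over the `N`-dimensional manifold `M`, of class `C^s` in the tangent vectors:
a Finsler metric function in every tangent space. (The tangent space `T_xM` of Mathlib is the
model `ℝᴺ`, through the preferred chart at `x`.) No regularity in `x` is imposed: families that
are smooth in `x` are a special case. -/
structure FinslerSpace (N : ℕ) (s : WithTop ℕ∞) (M : Type*) [TopologicalSpace M]
    [ChartedSpace (Vec N) M] where
  /-- The admissible tangent vectors at a point. -/
  dom : ∀ x : M, Set (TangentSpace (𝓡 N) x)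
  /-- The metric function `F(x, y)`. -/
  F : ∀ x : M, TangentSpace (𝓡 N) x → ℝ
  isFinsler : ∀ x : M, IsFinslerMetricFunction (n := N) s (dom x) (F x)

/-- The indicatrix `{y | F y = 1}` in a fixed tangent space. -/
def indicatrix {n : ℕ} (D : Set (Vec n)) (F : Vec n → ℝ) : Set (Vec n) :=
  {y | y ∈ D ∧ F y = 1}

/-- A `C^s` immersed local parametrization `u ↦ l(u)` of the indicatrix, which has dimension
`n - 1`, over an open set `U` of parameters `uᵃ`. -/
structure IsIndicatrixParam {n : ℕ} (s : WithTop ℕ∞) (D : Set (Vec n)) (F : Vec n → ℝ)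
    (U : Set (Vec (n - 1))) (l : Vec (n - 1) → Vec n) : Prop where
  isOpen : IsOpen U
  mapsTo : Set.MapsTo l U (indicatrix D F)
  contDiffOn : ContDiffOn ℝ s l U
  immersion : ∀ u ∈ U, Function.Injective (fderiv ℝ l u)

/-- The metric `i_ab(u) = g_mn(l(u)) (∂lᵐ/∂uᵃ) (∂lⁿ/∂uᵇ)` induced by the Finslerian metric
tensor along a parametrized piece of a hypersurface. -/
def inducedMetric {n : ℕ} (F : Vec n → ℝ) (l : Vec (n - 1) → Vec n) (u : Vec (n - 1)) :
    Matrix (Fin (n - 1)) (Fin (n - 1)) ℝ :=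
  Matrix.of fun a b => ∑ p, ∑ q, metricTensor F (l u) p q *
    pd (fun v => l v p) a u * pd (fun v => l v q) b u

/-- The indicatrix, with the Riemannian metric induced by the Finslerian metric tensor, is a space
of constant curvature `C`: in every local parametrization the curvature tensor, with its upper
index lowered to the second place, `I_acbd = i_ce I_a^e_bd`, is
`-C (i_cb i_ad - i_cd i_ab)`.  Here `I_a^e_bd = ∂_d i_a^e_b - ∂_b i_a^e_d + …`, which is
`curvature _ u a e d b`. -/
def IndicatrixHasConstantCurvature {n : ℕ} (s : WithTop ℕ∞) (D : Set (Vec n)) (F : Vec n → ℝ)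
    (C : ℝ) : Prop :=
  ∀ (U : Set (Vec (n - 1))) (l : Vec (n - 1) → Vec n), IsIndicatrixParam s D F U l →
    ∀ u ∈ U, ∀ a c b d : Fin (n - 1),
      ∑ e, inducedMetric F l u c e * curvature (inducedMetric F l) u a e d b
        = -C * (inducedMetric F l u c b * inducedMetric F l u a d
            - inducedMetric F l u c d * inducedMetric F l u a b)

/-! ### The conformal property -/

/-- The conformal transform `e^{2ψ} gᵢⱼ` of the Finslerian metric tensor with
`e^ψ = c₁ F^{c₂}`. -/
def conformalTensor {n : ℕ} (F : Vec n → ℝ) (c₁ c₂ : ℝ) (y : Vec n) :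
    Matrix (Fin n) (Fin n) ℝ :=
  (c₁ * F y ^ c₂) ^ 2 • metricTensor F y

/-- `ζ` is (the inverse of) a conformal isomorphism between a conical region of a tangent space
with Finsler metric function `F` and a region of the same tangent space with the Euclidean metric
`a`: it is a `C^r` diffeomorphism, positively homogeneous of degree `h`, it satisfies
`g_mn(y) = ϰ² (∂ζⁱ/∂yᵐ) (∂ζʲ/∂yⁿ) a_ij` with `ϰ = (1/h) F^{1-h}`, and exactly the unit vectors
are sent to unit vectors. -/
structure IsConformalIsomorphism {n : ℕ} (r : WithTop ℕ∞) (D : Set (Vec n)) (F : Vec n → ℝ)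
    (a : Vec n →L[ℝ] Vec n →L[ℝ] ℝ) (h : ℝ) (ζ : OpenPartialHomeomorph (Vec n) (Vec n)) :
    Prop where
  source_subset : ζ.source ⊆ D
  cone : ∀ y ∈ ζ.source, ∀ c : ℝ, 0 < c → c • y ∈ ζ.source
  contDiffOn : ContDiffOn ℝ r ζ ζ.source
  contDiffOn_symm : ContDiffOn ℝ r ζ.symm ζ.target
  homogeneous : ∀ y ∈ ζ.source, ∀ c : ℝ, 0 < c → ζ (c • y) = c ^ h • ζ y
  conformal : ∀ y ∈ ζ.source, ∀ p q : Fin n,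
    metricTensor F y p q = ((1 / h) * F y ^ (1 - h)) ^ 2 *
      a (fderiv ℝ ζ y (EuclideanSpace.single p 1)) (fderiv ℝ ζ y (EuclideanSpace.single q 1))
  unit : ∀ y ∈ ζ.source, (F y = 1 ↔ a (ζ y) (ζ y) = 1)

/-- The conformal property in a fixed tangent space, with exponent `h`: around every admissible
direction the tangent space with its Finslerian metric tensor is conformally isomorphic to the
tangent space with the Euclidean metric `a`. -/
def ConformalProperty {n : ℕ} (r : WithTop ℕ∞) (D : Set (Vec n)) (F : Vec n → ℝ)
    (a : Vec n →L[ℝ] Vec n →L[ℝ] ℝ) (h : ℝ) : Prop :=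
  ∀ y₀ ∈ D, ∃ ζ : OpenPartialHomeomorph (Vec n) (Vec n),
    y₀ ∈ ζ.source ∧ IsConformalIsomorphism r D F a h ζ

end Finsleroid

end

/-! Write y = F l with l on the indicatrix. The metric tensor g is homogeneous of degree 0 and l is
its unit normal along the indicatrix, so g = dF² + F² i with i the induced metric: the tangent space
is a metric cone over the indicatrix. If i has constant curvature C > 0, then C i is locally the
metric of the unit sphere of any Euclidean form B on the tangent space: there is a map χ of the
direction alone, into that sphere, with B(dχ, dχ) = C i. For κ² = C the map ζ = F^κ χ then satisfies
B(dζ, dζ) = κ² F^(2κ-2) (dF² + F² i) = κ² F^(2κ-2) g. Both claims follow. With κ = √C and B = a(x),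
ζ is the conformal isomorphism. With κ = 1 + c₂, of either sign, c₁² F^(2c₂) g is the pull-back of B
by (c₁/κ) ζ, hence flat.

The substance is the sphere map, `exists_sphere_map`. The position vector Ψ and its partial
derivatives must solve the Gauss-Weingarten equations, a linear total differential system whose
integrability (`gw_flat`) is the constancy of the curvature. Frobenius' theorem (`exists_parallel`)
gives a solution, obtained by integrating along rays, and `gram_eq_of_parallel` keeps the Gram
matrix of the frame equal to 1 ⊕ C i. The cone structure is `exists_cone_map`, the conformal
identity `metricForm_eq_powMap`, and flatness `curvature_pullback_eq_zero`.

Derivative count, with r = m + 2: F is C^(m+3), g and i are C^(m+1), the Christoffel symbols C^m,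
the frame C^(m+1), and Ψ is C^(m+2) = C^r. The condition r ≥ 3 provides the C¹ coefficients needed
for Frobenius and the C³ map needed for curvature. -/

/-! ### Linear total differential systems on a ball: existence and uniqueness. -/

section Parallel

open Set Metric Filter Topology

variable {E Z : Type*} [NormedAddCommGroup E] [NormedSpace ℝ E] [NormedAddCommGroup Z]
  [NormedSpace ℝ Z]

/-- A radial solution of a linear total differential system: `P` is parallel along every ray
issuing from the origin. -/
theorem exists_radially_parallel [CompleteSpace Z] {A : E → E →L[ℝ] Z →L[ℝ] Z} {δ K : ℝ}
    (hδ : 0 < δ) (hA : ContinuousOn A (closedBall 0 δ)) (hK : ∀ x ∈ closedBall (0 : E) δ, ‖A x‖ ≤ K)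
    (hKδ : K * δ ≤ 1 / 2) (P₀ : Z) :
    ∃ P : E → Z, Continuous P ∧ P 0 = P₀ ∧ (∃ B, ∀ x, ‖P x‖ ≤ B) ∧
      ∀ y ∈ closedBall (0 : E) δ, ∀ t ∈ Icc (0 : ℝ) 1,
        HasDerivWithinAt (fun s : ℝ => P (s • y)) (A (t • y) y (P (t • y))) (Icc 0 1) t := by
  have hK0 : 0 ≤ K := (norm_nonneg (A 0)).trans (hK 0 (by simp [hδ.le]))
  -- a retraction onto the closed ball
  set ρ : E → E := fun x => (δ / max δ ‖x‖) • x with hρ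
  have hmax : ∀ x : E, 0 < max δ ‖x‖ := fun x => lt_max_of_lt_left hδ
  have hρc : Continuous ρ := by
    refine Continuous.smul (continuous_const.div (by fun_prop) fun x => (hmax x).ne') continuous_id
  have hρn : ∀ x, ‖ρ x‖ ≤ δ := by
    intro x
    rw [hρ]
    simp only
    rw [norm_smul, Real.norm_of_nonneg (by positivity), div_mul_eq_mul_div,
      div_le_iff₀ (hmax x)]
    exact mul_le_mul_of_nonneg_left (le_max_right _ _) hδ.le
  have hρmem : ∀ x, ρ x ∈ closedBall (0 : E) δ := fun x => by simpa using hρn x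
  have hρid : ∀ x ∈ closedBall (0 : E) δ, ρ x = x := by
    intro x hx
    have : ‖x‖ ≤ δ := by simpa using hx
    simp [hρ, max_eq_left this, div_self hδ.ne']
  have hAc : Continuous fun x => A (ρ x) := hA.comp_continuous hρc hρmem
  have hAn : ∀ x, ‖A (ρ x)‖ ≤ K := fun x => hK _ (hρmem x)
  have hint : ∀ (P : E → Z) (_ : Continuous P),
      Continuous fun q : E × ℝ => A (ρ (q.2 • q.1)) (ρ q.1) (P (q.2 • q.1)) := by
    intro P hP
    have h1 : Continuous fun q : E × ℝ => q.2 • q.1 := by fun_prop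
    exact ((hAc.comp h1).clm_apply (hρc.comp continuous_fst)).clm_apply (hP.comp h1)
  have hbd : ∀ (P : E → Z) (B : ℝ) (_ : ∀ x, ‖P x‖ ≤ B) (y : E),
      ‖∫ t in (0 : ℝ)..1, A (ρ (t • y)) (ρ y) (P (t • y))‖ ≤ 1 / 2 * B := by
    intro P B hB y
    have hB0 : 0 ≤ B := (norm_nonneg _).trans (hB 0)
    have := intervalIntegral.norm_integral_le_of_norm_le_const (a := (0 : ℝ)) (b := 1)
      (f := fun t => A (ρ (t • y)) (ρ y) (P (t • y))) (C := 1 / 2 * B) ?_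
    · simpa using this
    · intro t _
      calc ‖A (ρ (t • y)) (ρ y) (P (t • y))‖
          ≤ ‖A (ρ (t • y))‖ * ‖ρ y‖ * ‖P (t • y)‖ := ContinuousLinearMap.le_opNorm₂ _ _ _
        _ ≤ K * δ * B := by gcongr; exacts [hAn _, hρn _, hB _]
        _ ≤ 1 / 2 * B := by gcongr
  -- The ray equation in integral form. The retraction `ρ` lets it act on bounded continuous
  -- functions on all of `E`, and `K * δ ≤ 1 / 2` makes it a contraction.
  let T : BoundedContinuousFunction E Z → BoundedContinuousFunction E Z := fun P =>
    BoundedContinuousFunction.ofNormedAddCommGroup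
      (fun y => P₀ + ∫ t in (0 : ℝ)..1, A (ρ (t • y)) (ρ y) (P (t • y)))
      (continuous_const.add (intervalIntegral.continuous_parametric_intervalIntegral_of_continuous'
        (hint P P.continuous) 0 1))
      (‖P₀‖ + 1 / 2 * ‖P‖)
      (fun y => (norm_add_le _ _).trans (by gcongr; exact hbd P _ P.norm_coe_le_norm y))
  have hT : ContractingWith (1 / 2) T := by
    refine ⟨by
      rw [← NNReal.coe_lt_coe]; norm_num, LipschitzWith.of_dist_le_mul fun P Q => ?_⟩
    rw [BoundedContinuousFunction.dist_le (by positivity)]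
    intro y
    have hi : ∀ R : BoundedContinuousFunction E Z, IntervalIntegrable
        (fun t : ℝ => A (ρ (t • y)) (ρ y) (R (t • y))) MeasureTheory.volume 0 1 := fun R =>
      ((hint R R.continuous).comp (Continuous.prodMk_right y)).intervalIntegrable _ _
    have h := hbd (fun x => P x - Q x) (dist P Q)
      (fun x => by rw [← dist_eq_norm]; exact P.dist_coe_le_dist x) y
    simp only [map_sub] at h
    rw [intervalIntegral.integral_sub (hi P) (hi Q)] at h
    simpa [T, dist_eq_norm] using h
  have hfix : T hT.fixedPoint = hT.fixedPoint := hT.fixedPoint_isFixedPt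
  set P := hT.fixedPoint with hPdef
  have hP : ∀ y, P y = P₀ + ∫ t in (0 : ℝ)..1, A (ρ (t • y)) (ρ y) (P (t • y)) := fun y =>
    (DFunLike.congr_fun hfix y).symm
  refine ⟨P, P.continuous, ?_, ⟨‖P‖, P.norm_coe_le_norm⟩, ?_⟩
  · rw [hP 0]; simp [hρ]
  intro y hy t ht
  have hmem : ∀ s ∈ Icc (0 : ℝ) 1, s • y ∈ closedBall (0 : E) δ := by
    intro s hs
    have hy' : ‖y‖ ≤ δ := by simpa using hy
    rw [mem_closedBall_zero_iff, norm_smul, Real.norm_of_nonneg hs.1]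
    nlinarith [norm_nonneg y, hs.2]
  have hf : Continuous fun s : ℝ => A (ρ (s • y)) y (P (s • y)) := by
    have h1 : Continuous fun s : ℝ => s • y := by fun_prop
    exact ((hAc.comp h1).clm_apply continuous_const).clm_apply (P.continuous.comp h1)
  have hray : ∀ s ∈ Icc (0 : ℝ) 1,
      P (s • y) = P₀ + ∫ t in (0 : ℝ)..s, A (ρ (t • y)) y (P (t • y)) := by
    intro s hs
    rw [hP, hρid _ (hmem s hs)]
    -- Rescaling time by `s` turns the integral over [0, 1] at `s • y` into one over [0, s] along
    -- the ray of `y`; linearity of `A` in its vector argument supplies the factor `s`.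
    have := intervalIntegral.smul_integral_comp_mul_right (a := 0) (b := 1)
      (fun t : ℝ => A (ρ (t • y)) y (P (t • y))) s
    simp only [zero_mul, one_mul] at this
    rw [← this, ← intervalIntegral.integral_smul]
    simp [smul_smul]
  have hd := (intervalIntegral.integral_hasDerivAt_right (hf.intervalIntegrable 0 t)
    (hf.stronglyMeasurableAtFilter _ _) hf.continuousAt).const_add P₀
  have hd' := hd.hasDerivWithinAt (s := Icc 0 1)
  rw [hρid _ (hmem t ht)] at hd'
  exact hd'.congr (fun s hs => hray s hs) (hray t ht)

set_option synthInstance.maxHeartbeats 200000 in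
set_option maxSynthPendingDepth 6 in
/-- Frobenius' theorem for linear total differential systems `dP = A P`: if the connection form
`A` is flat, there is a solution with a prescribed value at the origin. -/
theorem exists_parallel [ProperSpace E] [CompleteSpace Z] {A : E → E →L[ℝ] Z →L[ℝ] Z}
    {A' : E → E →L[ℝ] E →L[ℝ] Z →L[ℝ] Z} {ε : ℝ} (hε : 0 < ε)
    (hA : ∀ x ∈ closedBall (0 : E) ε, HasFDerivAt A (A' x) x)
    (hA' : ContinuousOn A' (closedBall 0 ε))
    (hflat : ∀ x ∈ closedBall (0 : E) ε, ∀ v w z,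
      A' x v w z + A x w (A x v z) = A' x w v z + A x v (A x w z)) :
    ∃ δ, 0 < δ ∧ δ ≤ ε ∧ ∀ P₀ : Z, ∃ P : E → Z, P 0 = P₀ ∧
      ∀ x ∈ ball (0 : E) δ, HasFDerivAt P ((A x).flip (P x)) x := by
  have hAc : ContinuousOn A (closedBall 0 ε) := fun x hx => (hA x hx).continuousAt.continuousWithinAt
  obtain ⟨K, hK⟩ := (isCompact_closedBall (0 : E) ε).exists_bound_of_continuousOn (f := A) hAc
  obtain ⟨K', hK'⟩ := (isCompact_closedBall (0 : E) ε).exists_bound_of_continuousOn (f := A') hA'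
  have hK0 : 0 ≤ K := (norm_nonneg (A 0)).trans (hK 0 (by simp [hε.le]))
  have hK'0 : 0 ≤ K' := (norm_nonneg (A' 0)).trans (hK' 0 (by simp [hε.le]))
  obtain ⟨δ, hδ, hδε, hKδ⟩ : ∃ δ, 0 < δ ∧ δ ≤ ε ∧ K * δ ≤ 1 / 2 := by
    refine ⟨min ε (1 / (2 * (K + 1))), by positivity, min_le_left _ _, ?_⟩
    calc K * min ε (1 / (2 * (K + 1))) ≤ (K + 1) * (1 / (2 * (K + 1))) := by
          gcongr
          · linarith
          · exact min_le_right _ _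
      _ = 1 / 2 := by field_simp
  have hsub : closedBall (0 : E) δ ⊆ closedBall 0 ε := closedBall_subset_closedBall hδε
  refine ⟨δ, hδ, hδε, fun P₀ => ?_⟩
  obtain ⟨P, hPc, hP0, ⟨B, hB⟩, hP⟩ := exists_radially_parallel hδ (hAc.mono hsub)
    (fun x hx => hK x (hsub hx)) hKδ P₀
  have hB0 : 0 ≤ B := (norm_nonneg _).trans (hB 0)
  refine ⟨P, hP0, fun y hy => ?_⟩
  have hyδ : ‖y‖ < δ := by simpa using hy
  -- Grönwall's factor at rate 1 on [0, 1], times the coefficient of `η * ‖v‖` in `hbound`.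
  set L := (Real.exp 1 - 1) * (δ * B + K' * B + K' * δ + K) with hL
  have hexp : (0 : ℝ) < Real.exp 1 - 1 := by linarith [Real.add_one_le_exp (1 : ℝ)]
  have hL0 : 0 ≤ L := by positivity
  suffices H : ∀ η, 0 < η → ∃ r, 0 < r ∧ ∀ v : E, ‖v‖ < r →
      ‖P (y + v) - P y - A y v (P y)‖ ≤ L * η * ‖v‖ by
    rw [hasFDerivAt_iff_isLittleO_nhds_zero, Asymptotics.isLittleO_iff]
    intro c hc
    obtain ⟨r, hr, h⟩ := H (c / (L + 1)) (by positivity)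
    filter_upwards [ball_mem_nhds (0 : E) hr] with v hv
    refine (h v (by simpa using hv)).trans ?_
    gcongr
    rw [mul_div_assoc', div_le_iff₀ (by positivity)]
    nlinarith
  intro η hη
  obtain ⟨r₁, hr₁, h₁⟩ := Metric.uniformContinuousOn_iff.1
    ((isCompact_closedBall (0 : E) ε).uniformContinuousOn_of_continuous hA') η hη
  obtain ⟨r₂, hr₂, h₂⟩ := Metric.uniformContinuousOn_iff.1
    ((isCompact_closedBall (0 : E) ε).uniformContinuousOn_of_continuous hPc.continuousOn) η hη
  refine ⟨min (min r₁ r₂) (min η (δ - ‖y‖)), by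
    have : 0 < δ - ‖y‖ := by linarith
    positivity, fun v hv => ?_⟩
  simp only [lt_min_iff] at hv
  obtain ⟨⟨hv₁, hv₂⟩, hvη, hvδ⟩ := hv
  have hyv : ‖y + v‖ ≤ δ := (norm_add_le _ _).trans (by linarith)
  have hscale : ∀ t ∈ Icc (0 : ℝ) 1, ∀ z : E, ‖t • z‖ ≤ ‖z‖ := by
    intro t ht z
    rw [norm_smul, Real.norm_of_nonneg ht.1]
    nlinarith [norm_nonneg z, ht.2]
  have hm1 : ∀ t ∈ Icc (0 : ℝ) 1, t • y ∈ closedBall (0 : E) ε := fun t ht => by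
    simpa using (hscale t ht y).trans (by linarith)
  have hm2 : ∀ t ∈ Icc (0 : ℝ) 1, t • (y + v) ∈ closedBall (0 : E) ε := fun t ht => by
    simpa using (hscale t ht (y + v)).trans (by linarith)
  -- The error of the expected first-order expansion of `P`, followed along the rays to `y` and `y +
  -- v`: it vanishes at `t = 0`, and at `t = 1` it is the remainder to be estimated.
  set f : ℝ → Z := fun t => P (t • (y + v)) - P (t • y) - A (t • y) (t • v) (P (t • y)) with hf
  set f' : ℝ → Z := fun t => A (t • (y + v)) (y + v) (P (t • (y + v))) - A (t • y) y (P (t • y))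
    - ((A' (t • y) y (t • v) + A (t • y) v) (P (t • y))
      + A (t • y) (t • v) (A (t • y) y (P (t • y)))) with hf'
  have hderiv : ∀ t ∈ Icc (0 : ℝ) 1, HasDerivWithinAt f (f' t) (Icc 0 1) t := by
    intro t ht
    have hyd : HasDerivWithinAt (fun s : ℝ => s • y) y (Icc 0 1) t := by
      simpa using (hasDerivWithinAt_id t (Icc (0 : ℝ) 1)).smul_const y
    have hvd : HasDerivWithinAt (fun s : ℝ => s • v) v (Icc 0 1) t := by
      simpa using (hasDerivWithinAt_id t (Icc (0 : ℝ) 1)).smul_const v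
    have hAd : HasDerivWithinAt (fun s : ℝ => A (s • y)) (A' (t • y) y) (Icc 0 1) t :=
      (hA _ (hm1 t ht)).comp_hasDerivWithinAt t hyd
    have h1 := hP (y + v) (by simpa using hyv) t ht
    have h2 := hP y (by simpa using hyδ.le) t ht
    exact (h1.sub h2).sub ((hAd.clm_apply hvd).clm_apply h2)
  have hbound : ∀ t ∈ Icc (0 : ℝ) 1, ‖f' t‖ ≤ 1 * ‖f t‖
      + η * ‖v‖ * (δ * B + K' * B + K' * δ + K) := by
    intro t ht
    have hx := hm1 t ht
    have hx' := hm2 t ht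
    have hd : t • (y + v) - t • y = t • v := by rw [smul_add]; abel
    have hTaylor : ‖A (t • (y + v)) - A (t • y) - A' (t • y) (t • v)‖ ≤ η * ‖v‖ := by
      have := (convex_segment (t • y) (t • (y + v))).norm_image_sub_le_of_norm_hasFDerivWithin_le'
        (f := A) (f' := A') (φ := A' (t • y)) (C := η) (x := t • y) (y := t • (y + v)) ?_ ?_
        (left_mem_segment _ _ _) (right_mem_segment _ _ _)
      · rw [hd] at this
        refine this.trans ?_
        gcongr
        exact hscale t ht v
      · intro x hxs
        exact (hA x ((convex_closedBall _ _).segment_subset hx hx' hxs)).hasFDerivWithinAt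
      · intro x hxs
        rw [← dist_eq_norm]
        refine (h₁ x ((convex_closedBall _ _).segment_subset hx hx' hxs) _ hx ?_).le
        have h3 : ‖x - t • y‖ ≤ ‖t • (y + v) - t • y‖ := by
          obtain ⟨θ, hθ, rfl⟩ := (segment_eq_image_lineMap ℝ (t • y) (t • (y + v))) ▸ hxs
          rw [AffineMap.lineMap_apply, vsub_eq_sub, vadd_eq_add, add_sub_cancel_right]
          exact hscale θ hθ _
        rw [dist_eq_norm]
        exact (h3.trans (by rw [hd]; exact hscale t ht v)).trans_lt hv₁
    have hPd : ‖P (t • (y + v)) - P (t • y)‖ ≤ η := by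
      rw [← dist_eq_norm]
      refine (h₂ _ hx' _ hx ?_).le
      rw [dist_eq_norm, hd]
      exact (hscale t ht v).trans_lt hv₂
    -- Flatness enters here: it exchanges the arguments `y` and `t • v` of `A'`. Apart from `A (t •
    -- y) y (f t)`, what remains is a Taylor remainder and products of two small quantities.
    have hsplit : f' t = A (t • y) y (f t)
        + ((A (t • (y + v)) - A (t • y) - A' (t • y) (t • v)) (y + v) (P (t • (y + v)))
          + A' (t • y) (t • v) v (P (t • (y + v)))
          + (A' (t • y) (t • v) y + A (t • y) v) (P (t • (y + v)) - P (t • y))) := by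
      have := hflat (t • y) hx y (t • v) (P (t • y))
      simp only [hf, hf', map_sub, map_add, add_apply, sub_apply] at this ⊢
      linear_combination (norm := module) (-1 : ℝ) • this
    have e1 : ‖A (t • y) y (f t)‖ ≤ 1 * ‖f t‖ := by
      refine (ContinuousLinearMap.le_opNorm₂ _ _ _).trans ?_
      gcongr
      calc ‖A (t • y)‖ * ‖y‖ ≤ K * δ := by gcongr; exact hK _ hx
        _ ≤ 1 := by linarith
    have e2 : ‖(A (t • (y + v)) - A (t • y) - A' (t • y) (t • v)) (y + v) (P (t • (y + v)))‖
        ≤ η * ‖v‖ * δ * B := by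
      refine (ContinuousLinearMap.le_opNorm₂ _ _ _).trans ?_
      gcongr
      exact hB _
    have e3 : ‖A' (t • y) (t • v) v (P (t • (y + v)))‖ ≤ K' * ‖v‖ * η * B := by
      refine (ContinuousLinearMap.le_opNorm₂ _ _ _).trans ?_
      gcongr
      · refine (ContinuousLinearMap.le_opNorm _ _).trans ?_
        gcongr
        exacts [hK' _ hx, hscale t ht v]
      · exact hB _
    have e4 : ‖(A' (t • y) (t • v) y + A (t • y) v) (P (t • (y + v)) - P (t • y))‖
        ≤ (K' * ‖v‖ * δ + K * ‖v‖) * η := by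
      refine (ContinuousLinearMap.le_opNorm _ _).trans ?_
      gcongr
      refine (norm_add_le _ _).trans ?_
      gcongr
      · refine (ContinuousLinearMap.le_opNorm₂ _ _ _).trans ?_
        gcongr
        exacts [hK' _ hx, hscale t ht v]
      · refine (ContinuousLinearMap.le_opNorm _ _).trans ?_
        gcongr
        exact hK _ hx
    rw [hsplit]
    refine (norm_add_le _ _).trans (add_le_add e1 (((norm_add_le _ _).trans
      (add_le_add ((norm_add_le _ _).trans (add_le_add e2 e3)) e4)).trans (le_of_eq (by ring))))
  have hG := norm_le_gronwallBound_of_norm_deriv_right_le (f := f) (f' := f') (δ := 0) (K := 1)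
    (a := 0) (b := 1) (fun t ht => (hderiv t ht).continuousWithinAt)
    (fun t ht => ((hderiv t (Ico_subset_Icc_self ht)).mono_of_mem_nhdsWithin
      (Icc_mem_nhdsGE_of_mem ht)))
    (by simp [hf]) (fun t ht => hbound t (Ico_subset_Icc_self ht)) 1 (by simp)
  rw [gronwallBound_of_K_ne_0 one_ne_zero] at hG
  simp only [hf, one_smul, sub_zero, mul_one, zero_mul, zero_add, div_one] at hG
  exact hG.trans (le_of_eq (by rw [hL]; ring))

set_option synthInstance.maxHeartbeats 200000 in
set_option maxSynthPendingDepth 6 in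
/-- Frobenius' theorem for `C¹` connection forms, flatness being stated for the values of the form. -/
theorem exists_parallel_of_contDiffOn [ProperSpace E] [CompleteSpace Z]
    {A : E → E →L[ℝ] Z →L[ℝ] Z} {ε : ℝ} (hε : 0 < ε) (hA : ContDiffOn ℝ 1 A (ball 0 ε))
    (hflat : ∀ x ∈ ball (0 : E) ε, ∀ v w z,
      fderiv ℝ (fun x => A x w z) x v + A x w (A x v z)
        = fderiv ℝ (fun x => A x v z) x w + A x v (A x w z)) :
    ∃ δ, 0 < δ ∧ δ < ε ∧ ∀ P₀ : Z, ∃ P : E → Z, P 0 = P₀ ∧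
      ∀ x ∈ ball (0 : E) δ, HasFDerivAt P ((A x).flip (P x)) x := by
  have hsub : closedBall (0 : E) (ε / 2) ⊆ ball 0 ε := closedBall_subset_ball (by linarith)
  have hd : ∀ x ∈ ball (0 : E) ε, HasFDerivAt A (fderiv ℝ A x) x := fun x hx =>
    ((hA.contDiffAt (isOpen_ball.mem_nhds hx)).differentiableAt one_ne_zero).hasFDerivAt
  have hd2 : ∀ x ∈ ball (0 : E) ε, ∀ v w z,
      fderiv ℝ (fun x => A x w z) x v = fderiv ℝ A x v w z := by
    intro x hx v w z
    have := ((hd x hx).clm_apply (hasFDerivAt_const w x)).clm_apply (hasFDerivAt_const z x)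
    rw [this.fderiv]
    simp
  obtain ⟨δ, hδ, hδε, h⟩ := exists_parallel (half_pos hε) (fun x hx => hd x (hsub hx))
    (((hA.fderiv_of_isOpen isOpen_ball (m := 0) (by simp)).continuousOn).mono hsub)
    (fun x hx v w z => by
      rw [← hd2 x (hsub hx), ← hd2 x (hsub hx)]
      exact hflat x (hsub hx) v w z)
  exact ⟨δ, hδ, by linarith, h⟩

/-- A map on a ball that vanishes at the centre and whose derivative is dominated by the map
vanishes. -/
theorem eq_zero_of_norm_hasFDerivAt_le {f : E → Z} {f' : E → E →L[ℝ] Z} {δ K : ℝ}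
    (hf : ∀ x ∈ ball (0 : E) δ, HasFDerivAt f (f' x) x)
    (hK : ∀ x ∈ ball (0 : E) δ, ‖f' x‖ ≤ K * ‖f x‖) (h0 : f 0 = 0) :
    ∀ x ∈ ball (0 : E) δ, f x = 0 := by
  intro x hx
  have hxδ : ‖x‖ < δ := by simpa using hx
  have hm : ∀ t ∈ Icc (0 : ℝ) 1, t • x ∈ ball (0 : E) δ := by
    intro t ht
    rw [mem_ball_zero_iff, norm_smul, Real.norm_of_nonneg ht.1]
    nlinarith [norm_nonneg x, ht.2]
  have hd : ∀ t ∈ Icc (0 : ℝ) 1, HasDerivAt (fun s : ℝ => f (s • x)) (f' (t • x) x) t := by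
    intro t ht
    have hxd : HasDerivAt (fun s : ℝ => s • x) x t := by
      simpa using (hasDerivAt_id t).smul_const x
    exact (hf _ (hm t ht)).comp_hasDerivAt t hxd
  have hG := norm_le_gronwallBound_of_norm_deriv_right_le (f := fun s : ℝ => f (s • x))
    (f' := fun t => f' (t • x) x) (δ := 0) (K := K * ‖x‖) (ε := 0)
    (a := 0) (b := 1) (fun t ht => (hd t ht).continuousAt.continuousWithinAt)
    (fun t ht => (hd t (Ico_subset_Icc_self ht)).hasDerivWithinAt)
    (by simp [h0]) (fun t ht => by
      have h1 := hK _ (hm t (Ico_subset_Icc_self ht))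
      refine (ContinuousLinearMap.le_opNorm _ _).trans ?_
      nlinarith [norm_nonneg x, norm_nonneg (f (t • x))]) 1 (by simp)
  simpa [gronwallBound_ε0_δ0] using hG

end Parallel

noncomputable section

namespace Finsleroid

/-! ### Gram matrices and existence of parallel frames. -/

section Frames

open Set Metric Filter Topology

/-- A positive definite symmetric bilinear form has an orthonormal basis. -/
theorem exists_orthonormal_basis {V : Type*} [AddCommGroup V] [Module ℝ V] [FiniteDimensional ℝ V]
    (B : LinearMap.BilinForm ℝ V) (hB : LinearMap.IsSymm B) (hpos : ∀ v, v ≠ 0 → 0 < B v v)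
    {ι : Type*} [Fintype ι] [DecidableEq ι] (hι : Fintype.card ι = Module.finrank ℝ V) :
    ∃ e : Module.Basis ι ℝ V, ∀ i j, B (e i) (e j) = if i = j then 1 else 0 := by
  obtain ⟨v, hv⟩ := LinearMap.BilinForm.exists_orthogonal_basis (K := ℝ) (B := B) hB
  let σ : Fin (Module.finrank ℝ V) ≃ ι := (Fintype.equivFinOfCardEq hι).symm
  have hp : ∀ i, 0 < B (v i) (v i) := fun i => hpos _ (v.ne_zero i)
  let w : Module.Basis (Fin (Module.finrank ℝ V)) ℝ V := v.isUnitSMul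
    (w := fun i => (Real.sqrt (B (v i) (v i)))⁻¹)
    fun i => (inv_ne_zero (Real.sqrt_pos.2 (hp i)).ne').isUnit
  refine ⟨w.reindex σ, fun i j => ?_⟩
  simp only [Module.Basis.reindex_apply, w, Module.Basis.isUnitSMul_apply, map_smul,
    LinearMap.smul_apply, smul_eq_mul]
  split_ifs with h
  · subst h
    have h1 := (Real.sqrt_pos.2 (hp (σ.symm i))).ne'
    field_simp
    rw [Real.sq_sqrt (hp _).le]
  · have : B (v (σ.symm i)) (v (σ.symm j)) = 0 := hv (fun h' => h (σ.symm.injective h'))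
    simp [this]

/-- Vectors with a prescribed positive definite Gram matrix. -/
theorem exists_gram_eq {V : Type*} [AddCommGroup V] [Module ℝ V] [FiniteDimensional ℝ V]
    (B : LinearMap.BilinForm ℝ V) (hB : LinearMap.IsSymm B) (hpos : ∀ v, v ≠ 0 → 0 < B v v)
    {ι : Type*} [Fintype ι] [DecidableEq ι] (hι : Fintype.card ι = Module.finrank ℝ V)
    {G : Matrix ι ι ℝ} (hG : G.PosDef) :
    ∃ p : ι → V, ∀ i j, B (p i) (p j) = G i j := by
  obtain ⟨e, he⟩ := exists_orthonormal_basis B hB hpos hι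
  have hsymm : G.IsSymm := by simpa [Matrix.IsHermitian, Matrix.IsSymm] using hG.1
  obtain ⟨f, hf⟩ := exists_orthonormal_basis (Matrix.toBilin' G)
    ⟨fun x y => by
      simp only [Matrix.toBilin'_apply', RingHom.id_apply]
      rw [Matrix.dotProduct_mulVec, ← Matrix.mulVec_transpose, hsymm.eq, dotProduct_comm]⟩
    (fun v hv => by simpa [Matrix.toBilin'_apply'] using hG.dotProduct_mulVec_pos hv)
    (ι := ι) (by simp)
  -- The linear map carrying a `G`-orthonormal basis to a `B`-orthonormal one is an isometry; the
  -- vectors sought are the images of the standard basis.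
  refine ⟨fun i => ∑ k, f.repr (Pi.single i 1) k • e k, fun i j => ?_⟩
  have key : ∀ x y : ι → ℝ,
      B (∑ k, f.repr x k • e k) (∑ k, f.repr y k • e k) = Matrix.toBilin' G x y := by
    intro x y
    conv_rhs => rw [← f.sum_repr x, ← f.sum_repr y]
    simp only [map_sum, map_smul, LinearMap.sum_apply, LinearMap.smul_apply, he, hf]
  rw [key]
  simp

theorem fderiv_apply_eq_sum {n : ℕ} {X : Type*} [NormedAddCommGroup X] [NormedSpace ℝ X]
    (L : Vec n →L[ℝ] X) (v : Vec n) : L v = ∑ i, v i • L (EuclideanSpace.single i 1) := by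
  conv_lhs => rw [show v = ∑ i, v i • EuclideanSpace.single i (1 : ℝ) by
    ext j; simp [Finset.sum_apply, Pi.single_apply]]
  simp

variable {n : ℕ} {ι : Type*} [Fintype ι] {W : Type*} [NormedAddCommGroup W] [NormedSpace ℝ W]

/-- The differential of the frame vector `p α` of a solution of
`∂_b p_α = ∑ β, M_bαβ p_β`. -/
def frameDeriv (M : Fin n → ι → ι → Vec n → ℝ) (p : ι → Vec n → W) (u : Vec n) (α : ι) :
    Vec n →L[ℝ] W :=
  ∑ b, (EuclideanSpace.proj b : Vec n →L[ℝ] ℝ).smulRight (∑ β, M b α β u • p β u)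

theorem frameDeriv_apply (M : Fin n → ι → ι → Vec n → ℝ) (p : ι → Vec n → W) (u : Vec n) (α : ι)
    (v : Vec n) : frameDeriv M p u α v = ∑ b, v b • ∑ β, M b α β u • p β u := by
  simp [frameDeriv]

theorem frameDeriv_single (M : Fin n → ι → ι → Vec n → ℝ) (p : ι → Vec n → W) (u : Vec n) (α : ι)
    (b : Fin n) :
    frameDeriv M p u α (EuclideanSpace.single b 1) = ∑ β, M b α β u • p β u := by
  rw [frameDeriv_apply, Finset.sum_eq_single b] <;> simp +contextual

set_option synthInstance.maxHeartbeats 200000 in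
set_option maxSynthPendingDepth 6 in
/-- A flat system `∂_b p_α = ∑ β, M_bαβ p_β` has solutions with prescribed initial vectors. -/
theorem exists_frame [CompleteSpace W] {M : Fin n → ι → ι → Vec n → ℝ} {ε : ℝ}
    (hε : 0 < ε) (hM : ∀ b α β, ContDiffOn ℝ 1 (M b α β) (ball 0 ε))
    (hflat : ∀ u ∈ ball (0 : Vec n) ε, ∀ b d α γ,
      pd (M b α γ) d u + ∑ β, M b α β u * M d β γ u
        = pd (M d α γ) b u + ∑ β, M d α β u * M b β γ u) :
    ∃ δ, 0 < δ ∧ δ < ε ∧ ∀ p₀ : ι → W, ∃ p : ι → Vec n → W, (∀ α, p α 0 = p₀ α) ∧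
      ∀ u ∈ ball (0 : Vec n) δ, ∀ α, HasFDerivAt (p α) (frameDeriv M p u α) u := by
  classical
  -- Matrix units: `T b α β` sends `v`, `z` to the family with `v b • z β` in slot `α` and 0
  -- elsewhere, so `A` is the connection form with matrices `M b`.
  let T : Fin n → ι → ι → (Vec n →L[ℝ] (ι → W) →L[ℝ] (ι → W)) := fun b α β =>
    (EuclideanSpace.proj b : Vec n →L[ℝ] ℝ).smulRight
      ((ContinuousLinearMap.single ℝ (fun _ : ι => W) α).comp (ContinuousLinearMap.proj β))
  let A : Vec n → Vec n →L[ℝ] (ι → W) →L[ℝ] (ι → W) := fun u =>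
    ∑ b, ∑ α, ∑ β, M b α β u • T b α β
  have hT : ∀ b α β v z α', T b α β v z α' = if α' = α then v b • z β else 0 := by
    intro b α β v z α'
    simp [T, Pi.single_apply]
  have hAz : ∀ u v z α, A u v z α = ∑ b, ∑ β, (v b * M b α β u) • z β := by
    intro u v z α
    simp only [A, sum_apply, smul_apply, Finset.sum_apply, Pi.smul_apply, hT]
    refine Finset.sum_congr rfl fun b _ => ?_
    rw [Finset.sum_eq_single α (by intros; simp_all [eq_comm]) (by simp)]
    simp [smul_smul, mul_comm]
  have hd : ∀ b α β, ∀ x ∈ ball (0 : Vec n) ε, HasFDerivAt (M b α β) (fderiv ℝ (M b α β) x) x :=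
    fun b α β x hx => (((hM b α β).contDiffAt (isOpen_ball.mem_nhds hx)).differentiableAt
        one_ne_zero).hasFDerivAt
  have hAd : ∀ u ∈ ball (0 : Vec n) ε, ∀ v w z α, fderiv ℝ (fun x => A x w z) u v α
      = ∑ b, ∑ d, ∑ γ, (v d * w b * pd (M b α γ) d u) • z γ := by
    intro u hu v w z α
    have h : HasFDerivAt (fun x => A x w z) (ContinuousLinearMap.pi fun α => ∑ b, ∑ β,
        (w b • fderiv ℝ (M b α β) u).smulRight (z β)) u := by
      rw [hasFDerivAt_pi']
      intro α
      simp only [hAz]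
      exact HasFDerivAt.fun_sum fun b _ => HasFDerivAt.fun_sum fun β _ =>
        ((hd b α β u hu).const_mul (w b)).smul_const (z β)
    rw [h.fderiv]
    simp only [ContinuousLinearMap.coe_pi', sum_apply, ContinuousLinearMap.smulRight_apply,
      smul_apply]
    refine Finset.sum_congr rfl fun b _ => ?_
    rw [Finset.sum_comm]
    refine Finset.sum_congr rfl fun γ _ => ?_
    rw [fderiv_apply_eq_sum (fderiv ℝ (M b α γ) u) v, Finset.smul_sum, Finset.sum_smul]
    refine Finset.sum_congr rfl fun d _ => ?_
    congr 1
    simp only [smul_eq_mul, pd]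
    ring
  have hAA : ∀ u v w z α, A u w (A u v z) α
      = ∑ b, ∑ d, ∑ γ, (v d * w b * ∑ β, M b α β u * M d β γ u) • z γ := by
    intro u v w z α
    rw [hAz]
    refine Finset.sum_congr rfl fun b _ => ?_
    simp only [hAz, Finset.smul_sum, Finset.mul_sum, Finset.sum_smul, smul_smul]
    rw [Finset.sum_comm]
    refine Finset.sum_congr rfl fun d _ => ?_
    rw [Finset.sum_comm]
    refine Finset.sum_congr rfl fun γ _ => Finset.sum_congr rfl fun β _ => ?_
    congr 1
    ring
  have hA : ContDiffOn ℝ 1 A (ball 0 ε) :=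
    ContDiffOn.sum fun b _ => ContDiffOn.sum fun α _ => ContDiffOn.sum fun β _ =>
      (hM b α β).smul contDiffOn_const
  obtain ⟨δ, hδ, hδε, h⟩ := exists_parallel_of_contDiffOn hε hA (by
    intro x hx v w z
    ext α
    simp only [Pi.add_apply, hAd x hx, hAA, ← Finset.sum_add_distrib, ← add_smul, ← mul_add]
    rw [Finset.sum_comm]
    refine Finset.sum_congr rfl fun d _ => Finset.sum_congr rfl fun b _ =>
      Finset.sum_congr rfl fun γ _ => ?_
    rw [hflat x hx b d α γ, mul_comm (v d)])
  refine ⟨δ, hδ, hδε, fun p₀ => ?_⟩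
  obtain ⟨P, hP0, hP⟩ := h p₀
  refine ⟨fun α u => P u α, fun α => congrFun hP0 α, fun u hu α => ?_⟩
  have := hasFDerivAt_pi'.1 (hP u hu) α
  refine this.congr_fderiv ?_
  ext1 v
  rw [frameDeriv_apply]
  simp [hAz, Finset.smul_sum, smul_smul]

end Frames

/-! ### Gram matrix and regularity of parallel frames. -/

section Frames

open Set Metric Filter Topology

variable {n : ℕ} {ι : Type*} [Fintype ι] {W : Type*} [NormedAddCommGroup W] [NormedSpace ℝ W]

theorem hasFDerivAt_of_pd {f : Vec n → ℝ} {u : Vec n} (hf : DifferentiableAt ℝ f u) :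
    HasFDerivAt f (∑ b, pd f b u • (EuclideanSpace.proj b : Vec n →L[ℝ] ℝ)) u := by
  refine hf.hasFDerivAt.congr_fderiv ?_
  ext1 v
  rw [fderiv_apply_eq_sum]
  simp [pd, mul_comm]

theorem proj_apply (b : Fin n) (v : Vec n) : (EuclideanSpace.proj b : Vec n →L[ℝ] ℝ) v = v b := rfl

/-- If the symmetric tensor `G` is parallel for the connection `M`, it is the Gram matrix of every
parallel frame of which it is the Gram matrix at the origin. -/
theorem gram_eq_of_parallel {M : Fin n → ι → ι → Vec n → ℝ} {p : ι → Vec n → W}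
    {G : ι → ι → Vec n → ℝ} {δ K : ℝ} (B : W →L[ℝ] W →L[ℝ] ℝ)
    (hp : ∀ u ∈ ball (0 : Vec n) δ, ∀ α, HasFDerivAt (p α) (frameDeriv M p u α) u)
    (hM : ∀ u ∈ ball (0 : Vec n) δ, ∀ b α β, |M b α β u| ≤ K)
    (hG : ∀ u ∈ ball (0 : Vec n) δ, ∀ α β, DifferentiableAt ℝ (G α β) u)
    (hGM : ∀ u ∈ ball (0 : Vec n) δ, ∀ b α β, pd (G α β) b u
      = ∑ γ, (M b α γ u * G γ β u + M b β γ u * G α γ u))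
    (h0 : ∀ α β, B (p α 0) (p β 0) = G α β 0) :
    ∀ u ∈ ball (0 : Vec n) δ, ∀ α β, B (p α u) (p β u) = G α β u := by
  -- The defect `q` satisfies a homogeneous linear system with bounded coefficients and vanishes at
  -- the origin, so it vanishes throughout.
  let q : Vec n → ι → ι → ℝ := fun u α β => B (p α u) (p β u) - G α β u
  let q' : Vec n → Vec n →L[ℝ] ι → ι → ℝ := fun u =>
    ContinuousLinearMap.pi fun α => ContinuousLinearMap.pi fun β =>
      ∑ b, (∑ γ, (M b α γ u * q u γ β + M b β γ u * q u α γ)) •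
        (EuclideanSpace.proj b : Vec n →L[ℝ] ℝ)
  have hq : ∀ u ∈ ball (0 : Vec n) δ, HasFDerivAt q (q' u) u := by
    intro u hu
    rw [hasFDerivAt_pi']
    intro α
    rw [hasFDerivAt_pi']
    intro β
    have h1 := B.hasFDerivAt_of_bilinear (hp u hu α) (hp u hu β)
    have h2 := h1.sub (hasFDerivAt_of_pd (hG u hu α β))
    refine h2.congr_fderiv ?_
    ext1 v
    simp only [q', q, sub_apply, add_apply, ContinuousLinearMap.comp_apply, sum_apply, smul_apply,
      ContinuousLinearMap.coe_pi', ContinuousLinearMap.proj_apply, ContinuousLinearMap.precompR_apply,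
      ContinuousLinearMap.precompL_apply, ContinuousLinearMap.compL_apply, frameDeriv_apply, map_sum, map_smul, smul_eq_mul,
      hGM u hu, proj_apply, Finset.mul_sum, Finset.sum_mul,
      ← Finset.sum_add_distrib, ← Finset.sum_sub_distrib]
    refine Finset.sum_congr rfl fun b _ => Finset.sum_congr rfl fun γ _ => ?_
    ring
  have hle : ∀ u ∈ ball (0 : Vec n) δ,
      ‖q' u‖ ≤ (Fintype.card (Fin n) * (Fintype.card ι * (2 * K))) * ‖q u‖ := by
    intro u hu
    have hK0 : ∀ (_ : ι) (_ : Fin n), 0 ≤ K := fun α b => (abs_nonneg _).trans (hM u hu b α α)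
    have hqn : ∀ α β, |q u α β| ≤ ‖q u‖ := fun α β =>
      (norm_le_pi_norm (q u α) β).trans (norm_le_pi_norm (q u) α)
    have hnn : 0 ≤ (Fintype.card (Fin n) * (Fintype.card ι * (2 * K))) * ‖q u‖ := by
      -- If `ι` or `Fin n` is empty, `hM` does not force `K` to be nonnegative, but then the product
      -- is 0.
      rcases isEmpty_or_nonempty ι with h | ⟨⟨α⟩⟩
      · simp
      rcases isEmpty_or_nonempty (Fin n) with h | ⟨⟨b⟩⟩
      · simp
      have := hK0 α b
      positivity
    refine ContinuousLinearMap.opNorm_le_bound _ hnn fun v => ?_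
    rw [pi_norm_le_iff_of_nonneg (by positivity)]
    intro α
    rw [pi_norm_le_iff_of_nonneg (by positivity)]
    intro β
    simp only [q', ContinuousLinearMap.coe_pi', sum_apply, smul_apply, smul_eq_mul,
      proj_apply]
    refine (norm_sum_le _ _).trans ?_
    refine (Finset.sum_le_card_nsmul _ _ (Fintype.card ι * (2 * K) * ‖q u‖ * ‖v‖)
      fun b _ => ?_).trans (le_of_eq ?_)
    · rw [norm_mul]
      refine mul_le_mul ?_ (PiLp.norm_apply_le v b) (norm_nonneg _) (by
        have := hK0 α b
        positivity)
      refine (norm_sum_le _ _).trans ?_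
      refine (Finset.sum_le_card_nsmul _ _ (2 * K * ‖q u‖) fun γ _ => ?_).trans (le_of_eq ?_)
      · refine (norm_add_le _ _).trans ?_
        rw [norm_mul, norm_mul, Real.norm_eq_abs, Real.norm_eq_abs, Real.norm_eq_abs,
          Real.norm_eq_abs]
        have := mul_le_mul (hM u hu b α γ) (hqn γ β) (abs_nonneg _) (hK0 α b)
        have := mul_le_mul (hM u hu b β γ) (hqn α γ) (abs_nonneg _) (hK0 α b)
        linarith
      · simp [nsmul_eq_mul]; ring
    · simp [nsmul_eq_mul]; ring
  intro u hu α β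
  have := eq_zero_of_norm_hasFDerivAt_le hq hle (by
    ext α β
    simp [q, h0]) u hu
  have := congrFun (congrFun this α) β
  simpa [q, sub_eq_zero] using this

/-- Solutions of a system with coefficients of class `C^m` are of class `C^(m+1)`. -/
theorem contDiffOn_frame {M : Fin n → ι → ι → Vec n → ℝ} {p : ι → Vec n → W} {δ : ℝ} {m : ℕ∞}
    (hp : ∀ u ∈ ball (0 : Vec n) δ, ∀ α, HasFDerivAt (p α) (frameDeriv M p u α) u)
    (hM : ∀ b α β, ContDiffOn ℝ m (M b α β) (ball 0 δ)) (α : ι) :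
    ContDiffOn ℝ ((m + 1 : ℕ∞) : WithTop ℕ∞) (p α) (ball 0 δ) := by
  -- Bootstrapping: the derivative of the frame is bilinear in `M` and `p`, so each pass gains one
  -- derivative as long as `M` allows it. Finite orders suffice, also for `m = ⊤`.
  have hstep : ∀ k : ℕ, (k : ℕ∞) ≤ m → (∀ β, ContDiffOn ℝ k (p β) (ball 0 δ)) →
      ∀ β, ContDiffOn ℝ (k + 1) (p β) (ball 0 δ) := by
    intro k hk h β
    rw [contDiffOn_succ_iff_fderiv_of_isOpen isOpen_ball]
    refine ⟨fun u hu => (hp u hu β).differentiableAt.differentiableWithinAt, by simp, ?_⟩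
    refine ContDiffOn.congr (f := fun u => frameDeriv M p u β) ?_ fun u hu => (hp u hu β).fderiv
    refine ContDiffOn.sum fun b _ => ?_
    exact contDiffOn_const.smulRight (ContDiffOn.sum fun γ _ =>
      ((hM b β γ).of_le (mod_cast hk)).smul (h γ))
  have hall : ∀ k : ℕ, (k : ℕ∞) ≤ m + 1 → ∀ β, ContDiffOn ℝ k (p β) (ball 0 δ) := by
    intro k
    induction k with
    | zero =>
      intro _ β
      simp only [Nat.cast_zero, contDiffOn_zero]
      exact fun u hu => (hp u hu β).continuousAt.continuousWithinAt
    | succ k ih =>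
      intro hk β
      have hk' : (k : ℕ∞) ≤ m := by
        have : (k : ℕ∞) + 1 ≤ m + 1 := by exact_mod_cast hk
        exact (ENat.add_le_add_iff_right (by simp)).1 this
      exact_mod_cast hstep k hk' (ih (hk'.trans le_self_add)) β
  rw [contDiffOn_iff_forall_nat_le]
  exact fun k hk => hall k hk α

end Frames

/-! ### The Gauss-Weingarten system and the map to the sphere. -/

section GaussWeingarten

open Set Metric Filter Topology

variable {n : ℕ}

/-- Matrices of the system `∂_b Ψ = Ψ_b`, `∂_b Ψ_a = Γᶜ_ab Ψ_c - C i_ab Ψ`, the frame being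
`Ψ` (index `none`) and `Ψ_a` (index `some a`). -/
def gwMatrix (i : Vec n → Matrix (Fin n) (Fin n) ℝ) (C : ℝ) (b : Fin n) :
    Option (Fin n) → Option (Fin n) → Vec n → ℝ
  | none, none => fun _ => 0
  | none, some c => fun _ => if b = c then 1 else 0
  | some a, none => fun u => -C * i u a b
  | some a, some c => fun u => christoffel i c a b u

/-- The Gram matrix `1 ⊕ C i` of the frame `Ψ`, `Ψ_a`. -/
def gwGram (i : Vec n → Matrix (Fin n) (Fin n) ℝ) (C : ℝ) :
    Option (Fin n) → Option (Fin n) → Vec n → ℝ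
  | none, none => fun _ => 1
  | none, some _ => fun _ => 0
  | some _, none => fun _ => 0
  | some a, some c => fun u => C * i u a c

theorem pd_symm {i : Vec n → Matrix (Fin n) (Fin n) ℝ} {U : Set (Vec n)} (hU : IsOpen U)
    (hsymm : ∀ u ∈ U, (i u).IsSymm) {u : Vec n} (hu : u ∈ U) (a b e : Fin n) :
    pd (fun z => i z a b) e u = pd (fun z => i z b a) e u := by
  unfold pd
  rw [Filter.EventuallyEq.fderiv_eq]
  filter_upwards [hU.mem_nhds hu] with z hz using (hsymm z hz).apply b a

theorem christoffel_symm {i : Vec n → Matrix (Fin n) (Fin n) ℝ} {U : Set (Vec n)} (hU : IsOpen U)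
    (hsymm : ∀ u ∈ U, (i u).IsSymm) {u : Vec n} (hu : u ∈ U) (c a b : Fin n) :
    christoffel i c a b u = christoffel i c b a u := by
  have : ∀ e, pd (fun z => i z a b) e u = pd (fun z => i z b a) e u := pd_symm hU hsymm hu a b
  simp only [christoffel, this]
  congr 1
  refine Finset.sum_congr rfl fun e _ => ?_
  ring

/-- Christoffel symbols with the upper index lowered. -/
theorem sum_mul_christoffel {i : Vec n → Matrix (Fin n) (Fin n) ℝ} {u : Vec n}
    (hdet : IsUnit (i u).det) (d a b : Fin n) :
    ∑ c, i u d c * christoffel i c a b u = (1 / 2) * (pd (fun z => i z d b) a u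
      + pd (fun z => i z d a) b u - pd (fun z => i z a b) d u) := by
  have h := Matrix.mul_nonsing_inv (i u) hdet
  simp only [christoffel, Finset.mul_sum]
  rw [Finset.sum_comm]
  have h' : ∀ e, ∑ c, i u d c * (i u)⁻¹ c e = if d = e then 1 else 0 := by
    intro e
    rw [← Matrix.mul_apply, h, Matrix.one_apply]
  have : ∀ e, ∑ c, i u d c * (1 / 2 * ((i u)⁻¹ c e * (pd (fun z => i z e b) a u
      + pd (fun z => i z e a) b u - pd (fun z => i z a b) e u)))
      = (∑ c, i u d c * (i u)⁻¹ c e) * (1 / 2 * (pd (fun z => i z e b) a u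
      + pd (fun z => i z e a) b u - pd (fun z => i z a b) e u)) := by
    intro e
    rw [Finset.sum_mul]
    refine Finset.sum_congr rfl fun c _ => ?_
    ring
  simp only [this, h']
  simp

theorem sum_christoffel_mul {i : Vec n → Matrix (Fin n) (Fin n) ℝ} {u : Vec n}
    (hs : (i u).IsSymm)
    (hdet : IsUnit (i u).det) (d a b : Fin n) :
    ∑ c, christoffel i c a b u * i u c d = (1 / 2) * (pd (fun z => i z d b) a u
      + pd (fun z => i z d a) b u - pd (fun z => i z a b) d u) := by
  rw [← sum_mul_christoffel hdet]
  refine Finset.sum_congr rfl fun c _ => ?_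
  rw [hs.apply d c, mul_comm]

theorem contDiffOn_pd {f : Vec n → ℝ} {U : Set (Vec n)} (hU : IsOpen U) {m k : WithTop ℕ∞}
    (hf : ContDiffOn ℝ k f U) (hm : m + 1 ≤ k) (b : Fin n) : ContDiffOn ℝ m (pd f b) U :=
  (hf.fderiv_of_isOpen hU hm).clm_apply contDiffOn_const

/-- By Cramer's rule the entries of the inverse are polynomials in the entries of the matrix,
divided by the determinant. -/
theorem contDiffOn_matrix_inv {i : Vec n → Matrix (Fin n) (Fin n) ℝ} {U : Set (Vec n)}
    {m : WithTop ℕ∞} (hi : ∀ a b, ContDiffOn ℝ m (fun u => i u a b) U)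
    (hdet : ∀ u ∈ U, IsUnit (i u).det) (a b : Fin n) :
    ContDiffOn ℝ m (fun u => (i u)⁻¹ a b) U := by
  have hdetc : ∀ {f : Vec n → Matrix (Fin n) (Fin n) ℝ},
      (∀ a b, ContDiffOn ℝ m (fun u => f u a b) U) → ContDiffOn ℝ m (fun u => (f u).det) U := by
    intro f hf
    simp only [Matrix.det_apply']
    exact ContDiffOn.sum fun σ _ => contDiffOn_const.mul (contDiffOn_prod fun j _ => hf _ _)
  simp only [Matrix.inv_def, Matrix.smul_apply, Ring.inverse_eq_inv', smul_eq_mul,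
    Matrix.adjugate_apply]
  refine ((hdetc hi).inv fun u hu => (hdet u hu).ne_zero).mul (hdetc fun c d => ?_)
  simp only [Matrix.updateRow_apply]
  split_ifs
  · exact contDiffOn_const
  · exact hi _ _

theorem contDiffOn_christoffel {i : Vec n → Matrix (Fin n) (Fin n) ℝ} {U : Set (Vec n)}
    (hU : IsOpen U) {m k : WithTop ℕ∞} (hi : ∀ a b, ContDiffOn ℝ k (fun u => i u a b) U)
    (hm : m + 1 ≤ k) (hdet : ∀ u ∈ U, IsUnit (i u).det) (c a b : Fin n) :
    ContDiffOn ℝ m (christoffel i c a b) U := by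
  refine contDiffOn_const.mul (ContDiffOn.sum fun e _ => ContDiffOn.mul
    (contDiffOn_matrix_inv (fun a b => (hi a b).of_le (le_self_add.trans hm)) hdet c e) ?_)
  exact ((contDiffOn_pd hU (hi _ _) hm _).add (contDiffOn_pd hU (hi _ _) hm _)).sub
    (contDiffOn_pd hU (hi _ _) hm _)

theorem pd_const_mul {f : Vec n → ℝ} {u : Vec n} (hf : DifferentiableAt ℝ f u) (c : ℝ)
    (e : Fin n) : pd (fun z => c * f z) e u = c * pd f e u := by
  rw [pd, (hf.hasFDerivAt.const_mul c).fderiv]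
  rfl

/-- In constant curvature `C` the Gauss-Weingarten system is integrable. -/
theorem gw_flat {i : Vec n → Matrix (Fin n) (Fin n) ℝ} {U : Set (Vec n)} (hU : IsOpen U)
    (hpos : ∀ u ∈ U, (i u).PosDef)
    (hi : ∀ a b, DifferentiableOn ℝ (fun u => i u a b) U)
    {C : ℝ} {u : Vec n} (hu : u ∈ U)
    (hcurv : ∀ a c b d, ∑ e, i u c e * curvature i u a e d b
      = -C * (i u c b * i u a d - i u c d * i u a b)) (b d : Fin n) (α γ : Option (Fin n)) :
    pd (gwMatrix i C b α γ) d u + ∑ β, gwMatrix i C b α β u * gwMatrix i C d β γ u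
      = pd (gwMatrix i C d α γ) b u + ∑ β, gwMatrix i C d α β u * gwMatrix i C b β γ u := by
  have hs : ∀ u ∈ U, (i u).IsSymm := fun u hu => by
    simpa [Matrix.IsHermitian, Matrix.IsSymm] using (hpos u hu).1
  have hdet : IsUnit (i u).det := (hpos u hu).det_pos.ne'.isUnit
  have hconst : ∀ (c : ℝ) (e : Fin n), pd (fun _ => c) e u = 0 := fun c e => by simp [pd]
  simp only [Fintype.sum_option]
  -- The four blocks are, in order: the symmetry of `i`; the symmetry of the Christoffel symbols;
  -- the Codazzi equation, which holds because the Levi-Civita connection preserves `i`; and the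
  -- Gauss equation. Only the last uses `hcurv`.
  rcases α with _ | a <;> rcases γ with _ | c
  · simp only [gwMatrix, hconst]
    simp [(hs u hu).apply b d]
  · simp only [gwMatrix, hconst]
    simp [christoffel_symm hU hs hu c b d]
  · have hd : ∀ a b e, pd (fun u => -C * i u a b) e u = -C * pd (fun u => i u a b) e u :=
      fun a b e => pd_const_mul ((hi a b).differentiableAt (hU.mem_nhds hu)) _ _
    simp only [gwMatrix, hd]
    have h1 : ∀ b d, ∑ e, christoffel i e a b u * (-C * i u e d)
        = -C * ((1 / 2) * (pd (fun z => i z d b) a u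
      + pd (fun z => i z d a) b u - pd (fun z => i z a b) d u)) := by
      intro b d
      rw [← sum_christoffel_mul (hs u hu) hdet, Finset.mul_sum]
      refine Finset.sum_congr rfl fun c _ => ?_
      ring
    rw [h1, h1, pd_symm hU hs hu d b a, pd_symm hU hs hu d a b, pd_symm hU hs hu b a d]
    ring
  -- Since `i u` is invertible, the index lowered in `hcurv` can be raised again.
  · have hX : ∀ e, curvature i u a e d b
        - C * (i u a b * (if d = e then 1 else 0) - i u a d * if b = e then 1 else 0) = 0 := by
      refine congrFun (Matrix.eq_zero_of_mulVec_eq_zero hdet.ne_zero (v := fun e =>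
        curvature i u a e d b
        - C * (i u a b * (if d = e then 1 else 0) - i u a d * if b = e then 1 else 0)) ?_)
      ext c
      simp only [Matrix.mulVec, dotProduct, mul_sub, Finset.sum_sub_distrib, hcurv, Pi.zero_apply]
      simp
      ring
    have h := hX c
    simp only [curvature, Finset.sum_sub_distrib] at h
    simp only [gwMatrix]
    linear_combination h

/-- A Riemannian metric `i` of constant curvature `C > 0` is, up to the factor `C`, locally
isometric to the unit sphere. -/
theorem exists_sphere_map {i : Vec n → Matrix (Fin n) (Fin n) ℝ} {ε : ℝ} (hε : 0 < ε) {m : ℕ∞}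
    (hm : 1 ≤ m)
    (hi : ∀ a b, ContDiffOn ℝ ((m + 1 : ℕ∞) : WithTop ℕ∞) (fun u => i u a b) (ball 0 ε))
    (hpos : ∀ u ∈ ball (0 : Vec n) ε, (i u).PosDef) {C : ℝ} (hC : 0 < C)
    (hcurv : ∀ u ∈ ball (0 : Vec n) ε, ∀ a c b d, ∑ e, i u c e * curvature i u a e d b
      = -C * (i u c b * i u a d - i u c d * i u a b))
    {W : Type*} [NormedAddCommGroup W] [NormedSpace ℝ W] [FiniteDimensional ℝ W]
    (hW : Module.finrank ℝ W = n + 1)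
    (B : W →L[ℝ] W →L[ℝ] ℝ) (hB : ∀ v w, B v w = B w v) (hBpos : ∀ v, v ≠ 0 → 0 < B v v) :
    ∃ δ, 0 < δ ∧ δ < ε ∧ ∃ Ψ : Vec n → W,
      ContDiffOn ℝ ((m + 2 : ℕ∞) : WithTop ℕ∞) Ψ (ball 0 δ) ∧
      ∀ u ∈ ball (0 : Vec n) δ, B (Ψ u) (Ψ u) = 1 ∧
        (∀ a, B (Ψ u) (fderiv ℝ Ψ u (EuclideanSpace.single a 1)) = 0) ∧
        ∀ a b, B (fderiv ℝ Ψ u (EuclideanSpace.single a 1))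
          (fderiv ℝ Ψ u (EuclideanSpace.single b 1)) = C * i u a b := by
  have : CompleteSpace W := FiniteDimensional.complete ℝ W
  have hs : ∀ u ∈ ball (0 : Vec n) ε, (i u).IsSymm := fun u hu => by
    simpa [Matrix.IsHermitian, Matrix.IsSymm] using (hpos u hu).1
  have hdet : ∀ u ∈ ball (0 : Vec n) ε, IsUnit (i u).det := fun u hu =>
    (hpos u hu).det_pos.ne'.isUnit
  have hid : ∀ a b, DifferentiableOn ℝ (fun u => i u a b) (ball 0 ε) := fun a b =>
    (hi a b).differentiableOn (by simp)
  have hM : ∀ b α β, ContDiffOn ℝ m (gwMatrix i C b α β) (ball 0 ε) := by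
    rintro b (_ | a) (_ | c)
    · exact contDiffOn_const
    · exact contDiffOn_const
    · exact contDiffOn_const.mul ((hi a b).of_le (mod_cast le_self_add))
    · exact contDiffOn_christoffel isOpen_ball hi (by simp) hdet c a b
  obtain ⟨δ, hδ, hδε, h⟩ := exists_frame (W := W) hε
    (fun b α β => (hM b α β).of_le (mod_cast hm))
    (fun u hu b d α γ => gw_flat isOpen_ball hpos hid hu (hcurv u hu) b d α γ)
  have hsub : ball (0 : Vec n) δ ⊆ ball 0 ε := ball_subset_ball hδε.le
  have h0 : (0 : Vec n) ∈ ball (0 : Vec n) ε := mem_ball_self hε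
  have hG0 : (Matrix.of fun α β => gwGram i C α β 0).PosDef := by
    refine Matrix.PosDef.of_dotProduct_mulVec_pos ?_ fun x hx => ?_
    · ext (_ | a) (_ | b)
      · simp [gwGram]
      · simp [gwGram]
      · simp [gwGram]
      · simp [gwGram, (hs 0 h0).apply a b]
    · have e : star x ⬝ᵥ (Matrix.of fun α β => gwGram i C α β 0).mulVec x
          = x none ^ 2 + C * ((star fun a => x (some a)) ⬝ᵥ (i 0).mulVec fun a => x (some a)) := by
        simp [dotProduct, Matrix.mulVec, Fintype.sum_option, gwGram, Finset.mul_sum]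
        rw [← sq]
        congr 1
        refine Finset.sum_congr rfl fun a _ => Finset.sum_congr rfl fun b _ => ?_
        ring
      rw [e]
      by_cases hxs : (fun a => x (some a)) = 0
      · have hn : x none ≠ 0 := by
          intro hn
          apply hx
          ext α
          rcases α with _ | a
          · exact hn
          · exact congrFun hxs a
        have := (hpos 0 h0).posSemidef.dotProduct_mulVec_nonneg fun a => x (some a)
        positivity
      · have := (hpos 0 h0).dotProduct_mulVec_pos hxs
        positivity
  -- The initial frame receives the Gram matrix that it is meant to keep; the matrix 1 ⊕ C i has
  -- size n + 1, the dimension of `W`.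
  obtain ⟨p₀, hp₀⟩ := exists_gram_eq (LinearMap.mk₂ ℝ (fun v w => B v w) (by simp) (by simp)
    (by simp) (by simp)) ⟨fun v w => hB v w⟩ hBpos (ι := Option (Fin n)) (by simp [hW]) hG0
  obtain ⟨p, hp0, hp⟩ := h p₀
  obtain ⟨K, hK⟩ : ∃ K, ∀ u ∈ ball (0 : Vec n) δ, ∀ b α β, |gwMatrix i C b α β u| ≤ K := by
    -- The strict inequality `δ < ε` puts the compact closed ball inside the domain of the
    -- coefficients.
    have hc : ∀ b α β, ∃ K, ∀ u ∈ closedBall (0 : Vec n) δ, ‖gwMatrix i C b α β u‖ ≤ K :=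
      fun b α β => (isCompact_closedBall _ _).exists_bound_of_continuousOn
        ((hM b α β).continuousOn.mono (closedBall_subset_ball hδε))
    choose K hK using hc
    refine ⟨∑ b, ∑ α, ∑ β, |K b α β|, fun u hu b α β => ?_⟩
    calc |gwMatrix i C b α β u| ≤ |K b α β| :=
          (hK b α β u (ball_subset_closedBall hu)).trans (le_abs_self _)
      _ ≤ ∑ β, |K b α β| := Finset.single_le_sum (f := fun β => |K b α β|)
          (fun _ _ => abs_nonneg _) (Finset.mem_univ β)
      _ ≤ ∑ α, ∑ β, |K b α β| := Finset.single_le_sum (f := fun α => ∑ β, |K b α β|)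
          (fun _ _ => by positivity) (Finset.mem_univ α)
      _ ≤ _ := Finset.single_le_sum (f := fun b => ∑ α, ∑ β, |K b α β|)
          (fun _ _ => by positivity) (Finset.mem_univ b)
  -- The tensor 1 ⊕ C i is parallel for the system: the mixed blocks cancel, and the tangential
  -- block is the compatibility of the Christoffel symbols with `i`.
  have hgram := gram_eq_of_parallel (G := gwGram i C) B hp hK (by
      rintro u hu (_ | a) (_ | c)
      · exact differentiableAt_const _
      · exact differentiableAt_const _
      · exact differentiableAt_const _
      · exact ((hid a c).differentiableAt (isOpen_ball.mem_nhds (hsub hu))).const_mul C)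
    (by
      intro u hu b
      have hsu := hs u (hsub hu)
      have hconst : ∀ (c : ℝ) (e : Fin n), pd (fun _ => c) e u = 0 := fun c e => by simp [pd]
      rintro (_ | a) (_ | c)
      · simp [gwGram, gwMatrix, hconst, Fintype.sum_option]
      · simp [gwGram, gwMatrix, hconst, Fintype.sum_option, hsu.apply c b]
      · simp [gwGram, gwMatrix, hconst, Fintype.sum_option]
      · have hd : pd (fun u => C * i u a c) b u = C * pd (fun u => i u a c) b u :=
          pd_const_mul ((hid a c).differentiableAt (isOpen_ball.mem_nhds (hsub hu))) _ _
        have h1 := sum_christoffel_mul hsu (hdet u (hsub hu)) c a b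
        have h2 := sum_mul_christoffel (hdet u (hsub hu)) a c b
        have e1 : ∑ e, christoffel i e a b u * (C * i u e c)
            = C * ∑ e, christoffel i e a b u * i u e c := by
          rw [Finset.mul_sum]
          exact Finset.sum_congr rfl fun e _ => by ring
        have e2 : ∑ e, christoffel i e c b u * (C * i u a e)
            = C * ∑ e, i u a e * christoffel i e c b u := by
          rw [Finset.mul_sum]
          exact Finset.sum_congr rfl fun e _ => by ring
        simp only [gwGram, gwMatrix, hd, Fintype.sum_option, Finset.sum_add_distrib, e1, e2, h1, h2]
        rw [pd_symm isOpen_ball hs (hsub hu) c b a, pd_symm isOpen_ball hs (hsub hu) c a b,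
          pd_symm isOpen_ball hs (hsub hu) a b c]
        ring)
    (by
      intro α β
      rw [hp0, hp0]
      exact hp₀ α β)
  have hsm := contDiffOn_frame hp (fun b α β => (hM b α β).mono hsub)
  have hfd : ∀ u ∈ ball (0 : Vec n) δ, ∀ a,
      fderiv ℝ (p none) u (EuclideanSpace.single a 1) = p (some a) u := by
    intro u hu a
    rw [(hp u hu none).fderiv, frameDeriv_single]
    simp [Fintype.sum_option, gwMatrix]
  refine ⟨δ, hδ, hδε, p none, ?_, fun u hu => ⟨?_, fun a => ?_, fun a b => ?_⟩⟩
  -- The partial derivatives of `p none` are themselves frame vectors, of class C^(m+1), so `p none`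
  -- has one derivative more.
  · have h2 : ((m + 2 : ℕ∞) : WithTop ℕ∞) = ((m + 1 : ℕ∞) : WithTop ℕ∞) + 1 := by
      rw [← one_add_one_eq_two, ← add_assoc]
      rfl
    rw [h2, contDiffOn_succ_iff_fderiv_of_isOpen isOpen_ball]
    refine ⟨fun u hu => (hp u hu none).differentiableAt.differentiableWithinAt, by simp, ?_⟩
    refine ContDiffOn.congr (f := fun u => ∑ b,
      (EuclideanSpace.proj b : Vec n →L[ℝ] ℝ).smulRight (p (some b) u)) ?_ fun u hu => ?_
    · exact ContDiffOn.sum fun b _ => contDiffOn_const.smulRight (hsm (some b))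
    · rw [(hp u hu none).fderiv]
      simp [frameDeriv, Fintype.sum_option, gwMatrix]
  · exact hgram u hu none none
  · rw [hfd u hu]
    exact hgram u hu none (some a)
  · rw [hfd u hu, hfd u hu]
    exact hgram u hu (some a) (some b)

end GaussWeingarten

/-! ### Coordinate-free form and homogeneity of the Finslerian metric tensor. -/

section FinslerForm

open Set Metric Filter Topology

variable {N : ℕ}

/-- The Finslerian metric tensor as a bilinear form. -/
def metricForm (F : Vec N → ℝ) (y : Vec N) : Vec N →L[ℝ] Vec N →L[ℝ] ℝ :=
  (1 / 2 : ℝ) • fderiv ℝ (fderiv ℝ fun z => F z ^ 2) y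

namespace IsFinslerMetricFunction

variable {s : WithTop ℕ∞} {D : Set (Vec N)} {F : Vec N → ℝ}

theorem contDiffOn_sq (hF : IsFinslerMetricFunction s D F) :
    ContDiffOn ℝ s (fun z => F z ^ 2) D := hF.contDiffOn.pow 2

theorem differentiableAt (hF : IsFinslerMetricFunction s D F) (hs : 1 ≤ s) {y : Vec N}
    (hy : y ∈ D) : DifferentiableAt ℝ F y :=
  (hF.contDiffOn.contDiffAt (hF.isOpen.mem_nhds hy)).differentiableAt
    (by rintro rfl; simp at hs)

theorem differentiableAt_fderiv_sq (hF : IsFinslerMetricFunction s D F) (hs : 2 ≤ s) {y : Vec N}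
    (hy : y ∈ D) : DifferentiableAt ℝ (fderiv ℝ fun z => F z ^ 2) y :=
  ((hF.contDiffOn_sq.fderiv_of_isOpen hF.isOpen (m := 1)
    (by rwa [one_add_one_eq_two])).contDiffAt (hF.isOpen.mem_nhds hy)).differentiableAt one_ne_zero

theorem metricTensor_eq (hF : IsFinslerMetricFunction s D F) (hs : 2 ≤ s) {y : Vec N}
    (hy : y ∈ D) (p q : Fin N) : metricTensor F y p q
      = metricForm F y (EuclideanSpace.single p 1) (EuclideanSpace.single q 1) := by
  have h := ((hF.differentiableAt_fderiv_sq hs hy).hasFDerivAt.clm_apply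
    (hasFDerivAt_const (EuclideanSpace.single q (1 : ℝ)) y)).fderiv
  have h' : pd (pd (fun z => F z ^ 2) q) p y = fderiv ℝ (fderiv ℝ fun z => F z ^ 2) y
      (EuclideanSpace.single p 1) (EuclideanSpace.single q 1) := by
    change fderiv ℝ (fun z => fderiv ℝ (fun z => F z ^ 2) z (EuclideanSpace.single q (1 : ℝ))) y
      (EuclideanSpace.single p 1) = _
    rw [h]
    simp
  simp [metricTensor, metricForm, h']

theorem metricForm_apply (hF : IsFinslerMetricFunction s D F) (hs : 2 ≤ s) {y : Vec N}
    (hy : y ∈ D) (v w : Vec N) :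
    metricForm F y v w = ∑ p, ∑ q, metricTensor F y p q * v p * w q := by
  rw [fderiv_apply_eq_sum (metricForm F y) v, sum_apply]
  refine Finset.sum_congr rfl fun p _ => ?_
  rw [smul_apply, fderiv_apply_eq_sum (metricForm F y (EuclideanSpace.single p 1)) w,
    Finset.smul_sum]
  refine Finset.sum_congr rfl fun q _ => ?_
  rw [hF.metricTensor_eq hs hy]
  simp only [smul_eq_mul]
  ring

theorem metricForm_symm (hF : IsFinslerMetricFunction s D F) (hs : 2 ≤ s) {y : Vec N}
    (hy : y ∈ D) (v w : Vec N) : metricForm F y v w = metricForm F y w v := by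
  rw [hF.metricForm_apply hs hy, hF.metricForm_apply hs hy, Finset.sum_comm]
  refine Finset.sum_congr rfl fun p _ => Finset.sum_congr rfl fun q _ => ?_
  have : metricTensor F y q p = metricTensor F y p q := by
    simpa using (hF.posDef y hy).1.apply p q
  rw [this]
  ring

theorem metricForm_pos (hF : IsFinslerMetricFunction s D F) (hs : 2 ≤ s) {y : Vec N}
    (hy : y ∈ D) {v : Vec N} (hv : v ≠ 0) : 0 < metricForm F y v v := by
  have h := (hF.posDef y hy).dotProduct_mulVec_pos (x := fun p => v p) (fun h => hv (by
    ext p; exact congrFun h p))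
  rw [hF.metricForm_apply hs hy]
  simp only [dotProduct, Matrix.mulVec, Finset.mul_sum, star_trivial, Pi.star_apply] at h
  refine h.trans_eq (Finset.sum_congr rfl fun p _ => Finset.sum_congr rfl fun q _ => ?_)
  ring

/-- The differential of `F²` is positively homogeneous of degree one. -/
theorem fderiv_smul_self (hF : IsFinslerMetricFunction s D F) (hs : 1 ≤ s) {y : Vec N}
    (hy : y ∈ D) {c : ℝ} (hc : 0 < c) :
    fderiv ℝ (fun z => F z ^ 2) (c • y) = c • fderiv ℝ (fun z => F z ^ 2) y := by
  have h1 := ((hF.differentiableAt hs (hF.smul_mem y hy c hc)).pow 2).hasFDerivAt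
  have h2 : HasFDerivAt (fun z : Vec N => c • z) (c • ContinuousLinearMap.id ℝ (Vec N)) y :=
    (hasFDerivAt_id y).const_smul c
  have h3 := h1.comp y h2
  have h4 := ((hF.differentiableAt hs hy).pow 2).hasFDerivAt.const_mul (c ^ 2)
  have h5 : (fun z => c ^ 2 * F z ^ 2) =ᶠ[𝓝 y] ((fun z => F z ^ 2) ∘ fun z => c • z) := by
    filter_upwards [hF.isOpen.mem_nhds hy] with z hz
    simp [hF.homogeneous z hz c hc, mul_pow]
  have h6 := (h3.congr_of_eventuallyEq h5).unique h4
  ext v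
  have h7 := congrArg (fun L => L v) h6
  simp only [ContinuousLinearMap.comp_apply, smul_apply, ContinuousLinearMap.id_apply, map_smul,
    smul_eq_mul] at h7 ⊢
  have : c * (fderiv ℝ (fun z => F z ^ 2) (c • y) v
      - c * fderiv ℝ (fun z => F z ^ 2) y v) = 0 := by
    linear_combination h7
  exact sub_eq_zero.1 ((mul_eq_zero.1 this).resolve_left hc.ne')

/-- The metric tensor is positively homogeneous of degree zero. -/
theorem metricForm_smul (hF : IsFinslerMetricFunction s D F) (hs : 2 ≤ s) {y : Vec N}
    (hy : y ∈ D) {c : ℝ} (hc : 0 < c) : metricForm F (c • y) = metricForm F y := by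
  have hs1 : 1 ≤ s := one_le_two.trans hs
  have h1 := (hF.differentiableAt_fderiv_sq hs (hF.smul_mem y hy c hc)).hasFDerivAt
  have h2 : HasFDerivAt (fun z : Vec N => c • z) (c • ContinuousLinearMap.id ℝ (Vec N)) y :=
    (hasFDerivAt_id y).const_smul c
  have h3 := h1.comp y h2
  have h4 := (hF.differentiableAt_fderiv_sq hs hy).hasFDerivAt.const_smul c
  have h5 : (fun z => c • fderiv ℝ (fun z => F z ^ 2) z)
      =ᶠ[𝓝 y] ((fderiv ℝ fun z => F z ^ 2) ∘ fun z => c • z) := by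
    filter_upwards [hF.isOpen.mem_nhds hy] with z hz
    exact (hF.fderiv_smul_self hs1 hz hc).symm
  have h6 := (h3.congr_of_eventuallyEq h5).unique h4
  ext v w
  have h7 := congrArg (fun L => L v w) h6
  simp only [ContinuousLinearMap.comp_apply, smul_apply, ContinuousLinearMap.id_apply, map_smul,
    smul_eq_mul] at h7
  simp only [metricForm, smul_apply, smul_eq_mul]
  rw [mul_left_cancel₀ hc.ne' h7]

/-- Euler's identity for the metric tensor. -/
theorem metricForm_self (hF : IsFinslerMetricFunction s D F) (hs : 2 ≤ s) {y : Vec N}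
    (hy : y ∈ D) (w : Vec N) : metricForm F y y w = F y * fderiv ℝ F y w := by
  have hs1 : 1 ≤ s := one_le_two.trans hs
  -- Differentiating the degree-one homogeneity of d(F²) in the scale `c` at `c = 1` gives D²(F²)(y,
  -- ·) = d(F²) = 2 F dF.
  have hγ : HasDerivAt (fun c : ℝ => c • y) y 1 := by simpa using (hasDerivAt_id (1 : ℝ)).smul_const y
  have h1 := HasFDerivAt.comp_hasDerivAt_of_eq (f := fun c : ℝ => c • y) (1 : ℝ)
    (hF.differentiableAt_fderiv_sq hs hy).hasFDerivAt hγ (by simp)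
  have h2 : HasDerivAt (fun c : ℝ => c • fderiv ℝ (fun z => F z ^ 2) y)
      (fderiv ℝ (fun z => F z ^ 2) y) 1 := by
    simpa using (hasDerivAt_id (1 : ℝ)).smul_const (fderiv ℝ (fun z => F z ^ 2) y)
  have h3 : (fun c : ℝ => c • fderiv ℝ (fun z => F z ^ 2) y)
      =ᶠ[𝓝 1] ((fderiv ℝ fun z => F z ^ 2) ∘ fun c : ℝ => c • y) := by
    filter_upwards [lt_mem_nhds (zero_lt_one' ℝ)] with c hc
    exact (hF.fderiv_smul_self hs1 hy hc).symm
  have h4 := (h1.congr_of_eventuallyEq h3).unique h2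
  have h5 := ((hF.differentiableAt hs1 hy).hasFDerivAt.pow 2).fderiv
  rw [metricForm, smul_apply, h4, h5]
  simp
  ring

theorem contDiffOn_metricTensor (hF : IsFinslerMetricFunction s D F) {m : WithTop ℕ∞}
    (hm : m + 1 + 1 ≤ s) (p q : Fin N) : ContDiffOn ℝ m (fun y => metricTensor F y p q) D :=
  contDiffOn_const.mul (contDiffOn_pd hF.isOpen
    (contDiffOn_pd hF.isOpen hF.contDiffOn_sq hm q) le_rfl p)

end IsFinslerMetricFunction

end FinslerForm

/-! ### The tangent space as a metric cone over the indicatrix. -/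

section ConeMap

open Set Metric Filter Topology

/-- A linear isomorphism of `ℝⁿ⁺¹` with `ℝ × ℝⁿ` that takes a given nonzero vector to `(1, 0)`. -/
theorem exists_equiv_prod {n : ℕ} {y₀ : Vec (n + 1)} (hy₀ : y₀ ≠ 0) :
    ∃ Φ : Vec (n + 1) ≃L[ℝ] ℝ × Vec n, Φ y₀ = (1, 0) := by
  have e : Vec (n + 1) ≃L[ℝ] ℝ × Vec n := ContinuousLinearEquiv.ofFinrankEq (by simp; omega)
  obtain ⟨T, hT⟩ := SeparatingDual.exists_continuousLinearEquiv_apply_eq (R := ℝ)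
    (x := e y₀) (y := ((1, 0) : ℝ × Vec n)) (by simpa using hy₀) (by simp)
  exact ⟨e.trans T, hT⟩

variable {n : ℕ} (Φ : Vec (n + 1) ≃L[ℝ] ℝ × Vec n)

/-- Inhomogeneous coordinates of a direction. -/
def dirCoord (y : Vec (n + 1)) : Vec n := (Φ y).1⁻¹ • (Φ y).2

/-- The central projection of an affine hyperplane to the indicatrix, as a parametrization. -/
def indParam (F : Vec (n + 1) → ℝ) (u : Vec n) : Vec (n + 1) :=
  (F (Φ.symm (1, u)))⁻¹ • Φ.symm (1, u)

variable {Φ}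

theorem dirCoord_smul {c : ℝ} (hc : 0 < c) (y : Vec (n + 1)) :
    dirCoord Φ (c • y) = dirCoord Φ y := by
  simp only [dirCoord, map_smul, Prod.smul_fst, Prod.smul_snd, smul_smul, smul_eq_mul]
  congr 1
  field_simp

theorem contDiffOn_dirCoord {m : WithTop ℕ∞} :
    ContDiffOn ℝ m (dirCoord Φ) {y | 0 < (Φ y).1} := by
  refine ContDiffOn.smul (ContDiffOn.inv ?_ fun y hy => (show 0 < (Φ y).1 from hy).ne') ?_
  · exact (contDiff_fst.comp Φ.contDiff).contDiffOn
  · exact (contDiff_snd.comp Φ.contDiff).contDiffOn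

theorem isOpen_fst_pos : IsOpen {y : Vec (n + 1) | 0 < (Φ y).1} :=
  isOpen_lt continuous_const (continuous_fst.comp Φ.continuous)

theorem smul_symm_dirCoord {y : Vec (n + 1)} (hy : 0 < (Φ y).1) :
    (Φ y).1 • Φ.symm (1, dirCoord Φ y) = y := by
  rw [← map_smul, Φ.symm_apply_eq]
  ext1
  · simp
  · simp [dirCoord, smul_smul, mul_inv_cancel₀ hy.ne']

theorem symm_dirCoord {y : Vec (n + 1)} (hy : 0 < (Φ y).1) :
    Φ.symm (1, dirCoord Φ y) = (Φ y).1⁻¹ • y := by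
  conv_rhs => rw [← smul_symm_dirCoord hy]
  simp [smul_smul, inv_mul_cancel₀ hy.ne']

variable {s : WithTop ℕ∞} {D : Set (Vec (n + 1))} {F : Vec (n + 1) → ℝ} {ε : ℝ}

theorem contDiffOn_indParam (hF : IsFinslerMetricFunction s D F)
    (hε : ∀ u ∈ ball (0 : Vec n) ε, Φ.symm (1, u) ∈ D) :
    ContDiffOn ℝ s (indParam Φ F) (ball 0 ε) := by
  have h : ContDiff ℝ s fun u : Vec n => Φ.symm (1, u) :=
    Φ.symm.contDiff.comp (contDiff_const.prodMk contDiff_id)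
  exact ((hF.contDiffOn.comp h.contDiffOn hε).inv fun u hu => (hF.pos _ (hε u hu)).ne').smul
    h.contDiffOn

theorem indParam_mem (hF : IsFinslerMetricFunction s D F)
    (hε : ∀ u ∈ ball (0 : Vec n) ε, Φ.symm (1, u) ∈ D) {u : Vec n} (hu : u ∈ ball (0 : Vec n) ε) :
    indParam Φ F u ∈ indicatrix D F := by
  have hp := hF.pos _ (hε u hu)
  refine ⟨hF.smul_mem _ (hε u hu) _ (inv_pos.2 hp), ?_⟩
  rw [indParam, hF.homogeneous _ (hε u hu) _ (inv_pos.2 hp), inv_mul_cancel₀ hp.ne']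

theorem fst_indParam_pos (hF : IsFinslerMetricFunction s D F)
    (hε : ∀ u ∈ ball (0 : Vec n) ε, Φ.symm (1, u) ∈ D) {u : Vec n} (hu : u ∈ ball (0 : Vec n) ε) :
    0 < (Φ (indParam Φ F u)).1 := by
  have hp := hF.pos _ (hε u hu)
  simpa [indParam] using hp

theorem dirCoord_indParam (hF : IsFinslerMetricFunction s D F)
    (hε : ∀ u ∈ ball (0 : Vec n) ε, Φ.symm (1, u) ∈ D) {u : Vec n} (hu : u ∈ ball (0 : Vec n) ε) :
    dirCoord Φ (indParam Φ F u) = u := by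
  rw [indParam, dirCoord_smul (inv_pos.2 (hF.pos _ (hε u hu)))]
  simp [dirCoord]

/-- `dirCoord Φ` is a left inverse of the parametrization, so by the chain rule its differential is
a left inverse of the differential. -/
theorem injective_fderiv_indParam (hF : IsFinslerMetricFunction s D F) (hs : 1 ≤ s)
    (hε : ∀ u ∈ ball (0 : Vec n) ε, Φ.symm (1, u) ∈ D) {u : Vec n} (hu : u ∈ ball (0 : Vec n) ε) :
    Function.Injective (fderiv ℝ (indParam Φ F) u) := by
  have h1 : DifferentiableAt ℝ (indParam Φ F) u :=
    ((contDiffOn_indParam hF hε).contDiffAt (isOpen_ball.mem_nhds hu)).differentiableAt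
      (by rintro rfl; simp at hs)
  have h2 : DifferentiableAt ℝ (dirCoord Φ) (indParam Φ F u) :=
    ((contDiffOn_dirCoord (m := 1)).contDiffAt
      (isOpen_fst_pos.mem_nhds (fst_indParam_pos hF hε hu))).differentiableAt one_ne_zero
  have h3 := h2.hasFDerivAt.comp u h1.hasFDerivAt
  have h4 : (fun u => u) =ᶠ[𝓝 u] (dirCoord Φ ∘ indParam Φ F) := by
    filter_upwards [isOpen_ball.mem_nhds hu] with z hz
    exact (dirCoord_indParam hF hε hz).symm
  have h5 := (h3.congr_of_eventuallyEq h4).unique (hasFDerivAt_id u)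
  exact Function.LeftInverse.injective (g := fderiv ℝ (dirCoord Φ) (indParam Φ F u)) fun v =>
    congrArg (fun L => L v) h5

/-- This is the parametrization on which the curvature hypothesis is used. The parameter space `Vec
(n + 1 - 1)` is `Vec n` by definitional reduction. -/
theorem isIndicatrixParam (hF : IsFinslerMetricFunction s D F) (hs : 1 ≤ s)
    (hε : ∀ u ∈ ball (0 : Vec n) ε, Φ.symm (1, u) ∈ D) :
    IsIndicatrixParam (n := n + 1) s D F (ball (0 : Vec n) ε) (indParam Φ F) where
  isOpen := isOpen_ball
  mapsTo _ hu := indParam_mem hF hε hu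
  contDiffOn := contDiffOn_indParam hF hε
  immersion _ hu := injective_fderiv_indParam hF hs hε hu

/-- The metric induced on the indicatrix, in the parametrization `indParam`. -/
def indMetric (Φ : Vec (n + 1) ≃L[ℝ] ℝ × Vec n) (F : Vec (n + 1) → ℝ) :
    Vec n → Matrix (Fin n) (Fin n) ℝ :=
  inducedMetric (n := n + 1) F (indParam Φ F)

theorem pd_apply_eq {k N : ℕ} {l : Vec k → Vec N} {u : Vec k} (hl : DifferentiableAt ℝ l u)
    (p : Fin N) (a : Fin k) :
    pd (fun v => l v p) a u = (fderiv ℝ l u (EuclideanSpace.single a 1)) p := by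
  have := ((EuclideanSpace.proj p : Vec N →L[ℝ] ℝ).hasFDerivAt (x := l u)).comp u hl.hasFDerivAt
  exact congrArg (fun L => L (EuclideanSpace.single a 1)) this.fderiv

theorem indMetric_apply (hF : IsFinslerMetricFunction s D F) (hs : 2 ≤ s)
    (hε : ∀ u ∈ ball (0 : Vec n) ε, Φ.symm (1, u) ∈ D) {u : Vec n} (hu : u ∈ ball (0 : Vec n) ε)
    (a b : Fin n) : indMetric Φ F u a b = metricForm F (indParam Φ F u)
      (fderiv ℝ (indParam Φ F) u (EuclideanSpace.single a 1))
      (fderiv ℝ (indParam Φ F) u (EuclideanSpace.single b 1)) := by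
  have h1 : DifferentiableAt ℝ (indParam Φ F) u :=
    ((contDiffOn_indParam hF hε).contDiffAt (isOpen_ball.mem_nhds hu)).differentiableAt
      (by rintro rfl; simp at hs)
  rw [hF.metricForm_apply hs (indParam_mem hF hε hu).1]
  simp only [← pd_apply_eq h1]
  rfl

theorem sum_indMetric (hF : IsFinslerMetricFunction s D F) (hs : 2 ≤ s)
    (hε : ∀ u ∈ ball (0 : Vec n) ε, Φ.symm (1, u) ∈ D) {u : Vec n} (hu : u ∈ ball (0 : Vec n) ε)
    (v w : Vec n) : ∑ a, ∑ b, v a * (indMetric Φ F u a b * w b) = metricForm F (indParam Φ F u)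
      (fderiv ℝ (indParam Φ F) u v) (fderiv ℝ (indParam Φ F) u w) := by
  rw [fderiv_apply_eq_sum (fderiv ℝ (indParam Φ F) u) v,
    fderiv_apply_eq_sum (fderiv ℝ (indParam Φ F) u) w]
  simp only [indMetric_apply hF hs hε hu, map_sum, map_smul, sum_apply, smul_apply, smul_eq_mul,
    Finset.mul_sum]
  rw [Finset.sum_comm]
  refine Finset.sum_congr rfl fun b _ => Finset.sum_congr rfl fun a _ => ?_
  ring

theorem posDef_indMetric (hF : IsFinslerMetricFunction s D F) (hs : 2 ≤ s)
    (hε : ∀ u ∈ ball (0 : Vec n) ε, Φ.symm (1, u) ∈ D) {u : Vec n}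
    (hu : u ∈ ball (0 : Vec n) ε) : (indMetric Φ F u).PosDef := by
  have hm := (indParam_mem hF hε hu).1
  refine Matrix.PosDef.of_dotProduct_mulVec_pos ?_ fun x hx => ?_
  · ext a b
    rw [Matrix.conjTranspose_apply, star_trivial, indMetric_apply hF hs hε hu,
      indMetric_apply hF hs hε hu, hF.metricForm_symm hs hm]
  · have h := sum_indMetric hF hs hε hu (WithLp.toLp 2 x) (WithLp.toLp 2 x)
    have h0 : fderiv ℝ (indParam Φ F) u (WithLp.toLp 2 x) ≠ 0 := by
      intro h0
      have := injective_fderiv_indParam hF (one_le_two.trans hs) hε hu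
        (h0.trans (map_zero _).symm)
      exact hx (congrArg (WithLp.ofLp) this)
    have h1 := hF.metricForm_pos hs hm h0
    rw [← h] at h1
    simpa [dotProduct, Matrix.mulVec, Finset.mul_sum] using h1

/-- The loss of two derivatives comes from the metric tensor, a second derivative of F²; the tangent
vectors of the parametrization lose only one. -/
theorem contDiffOn_indMetric {m : ℕ∞}
    (hF : IsFinslerMetricFunction ((m + 3 : ℕ∞) : WithTop ℕ∞) D F)
    (hε : ∀ u ∈ ball (0 : Vec n) ε, Φ.symm (1, u) ∈ D) (a b : Fin n) :
    ContDiffOn ℝ ((m + 1 : ℕ∞) : WithTop ℕ∞) (fun u => indMetric Φ F u a b) (ball 0 ε) := by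
  have hl := contDiffOn_indParam hF hε
  have e3 : m + 3 = m + 1 + 1 + 1 := by
    rw [add_assoc, add_assoc]; rfl
  have hlp : ∀ p, ContDiffOn ℝ ((m + 3 : ℕ∞) : WithTop ℕ∞) (fun v => indParam Φ F v p)
      (ball 0 ε) := fun p =>
    (EuclideanSpace.proj p : Vec (n + 1) →L[ℝ] ℝ).contDiff.comp_contDiffOn hl
  have hlpd : ∀ p a, ContDiffOn ℝ ((m + 1 : ℕ∞) : WithTop ℕ∞)
      (pd (fun v => indParam Φ F v p) a) (ball 0 ε) := fun p a =>
    contDiffOn_pd isOpen_ball (hlp p) (by rw [e3]; exact_mod_cast le_self_add) a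
  have e : (fun u => indMetric Φ F u a b) = fun u => ∑ p, ∑ q, metricTensor F (indParam Φ F u) p q *
      pd (fun v => indParam Φ F v p) a u * pd (fun v => indParam Φ F v q) b u := rfl
  rw [e]
  refine ContDiffOn.sum fun p _ => ContDiffOn.sum fun q _ => ((ContDiffOn.comp
    (g := fun y => metricTensor F y p q) ?_ (hl.of_le ?_)
    fun u hu => (indParam_mem hF hε hu).1).mul (hlpd p a)).mul (hlpd q b)
  · exact hF.contDiffOn_metricTensor (by rw [e3]; exact_mod_cast le_rfl) p q
  · rw [e3, add_assoc]; exact_mod_cast le_self_add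

/-- Around every admissible direction, the Finsler metric of a tangent space whose indicatrix has
constant curvature `C > 0` is `dF² + (F² / C) χ^* B`, where `χ` is positively homogeneous of degree
zero with values in the unit sphere of a given Euclidean metric `B`. -/
theorem exists_cone_map {m : ℕ∞} (hm : 1 ≤ m)
    (hF : IsFinslerMetricFunction ((m + 3 : ℕ∞) : WithTop ℕ∞) D F) {C : ℝ} (hC : 0 < C)
    (hcurv : IndicatrixHasConstantCurvature (n := n + 1) ((m + 3 : ℕ∞) : WithTop ℕ∞) D F C)
    (B : Vec (n + 1) →L[ℝ] Vec (n + 1) →L[ℝ] ℝ) (hB : ∀ v w, B v w = B w v)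
    (hBpos : ∀ v, v ≠ 0 → 0 < B v v) {y₀ : Vec (n + 1)} (hy₀ : y₀ ∈ D) :
    ∃ (V : Set (Vec (n + 1))) (χ : Vec (n + 1) → Vec (n + 1)), IsOpen V ∧ y₀ ∈ V ∧ V ⊆ D ∧
      (∀ y ∈ V, ∀ c : ℝ, 0 < c → c • y ∈ V) ∧
      ContDiffOn ℝ ((m + 2 : ℕ∞) : WithTop ℕ∞) χ V ∧
      (∀ y, ∀ c : ℝ, 0 < c → χ (c • y) = χ y) ∧
      ∀ y ∈ V, B (χ y) (χ y) = 1 ∧ (∀ v, B (χ y) (fderiv ℝ χ y v) = 0) ∧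
        ∀ v w, C * metricForm F y v w = C * (fderiv ℝ F y v * fderiv ℝ F y w)
          + F y ^ 2 * B (fderiv ℝ χ y v) (fderiv ℝ χ y w) := by
  have hs2 : (2 : WithTop ℕ∞) ≤ ((m + 3 : ℕ∞) : WithTop ℕ∞) := by
    have : (2 : ℕ∞) ≤ m + 3 := le_add_left (by norm_num)
    change ((2 : ℕ∞) : WithTop ℕ∞) ≤ _
    exact_mod_cast this
  have hs1 : (1 : WithTop ℕ∞) ≤ ((m + 3 : ℕ∞) : WithTop ℕ∞) := one_le_two.trans hs2
  obtain ⟨Φ, hΦ⟩ := exists_equiv_prod (y₀ := y₀) (fun h => hF.zero_notMem (h ▸ hy₀))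
  obtain ⟨ε, hε0, hε⟩ : ∃ ε, 0 < ε ∧ ∀ u ∈ ball (0 : Vec n) ε, Φ.symm (1, u) ∈ D := by
    have hc : Continuous fun u : Vec n => Φ.symm (1, u) := by fun_prop
    have : (fun u : Vec n => Φ.symm (1, u)) ⁻¹' D ∈ 𝓝 0 :=
      hc.continuousAt.preimage_mem_nhds (hF.isOpen.mem_nhds (by
        rw [← hΦ]; simpa using hy₀))
    obtain ⟨ε, h, h'⟩ := Metric.mem_nhds_iff.1 this
    exact ⟨ε, h, fun u hu => h' hu⟩
  obtain ⟨δ, hδ, hδε, Ψ, hΨ, hΨB⟩ := exists_sphere_map hε0 hm (contDiffOn_indMetric hF hε)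
    (fun u hu => posDef_indMetric hF hs2 hε hu) hC
    (hcurv (ball (0 : Vec n) ε) (indParam Φ F) (isIndicatrixParam hF hs1 hε))
    (W := Vec (n + 1)) (by simp) B hB hBpos
  have hsub : ball (0 : Vec n) δ ⊆ ball 0 ε := ball_subset_ball hδε.le
  set V : Set (Vec (n + 1)) := {y | 0 < (Φ y).1} ∩ dirCoord Φ ⁻¹' ball 0 δ with hV
  have hVopen : IsOpen V :=
    (contDiffOn_dirCoord (m := 1)).continuousOn.isOpen_inter_preimage isOpen_fst_pos isOpen_ball
  have hVD : V ⊆ D := by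
    intro y hy
    rw [← smul_symm_dirCoord hy.1]
    exact hF.smul_mem _ (hε _ (hsub hy.2)) _ hy.1
  have hrec : ∀ y ∈ V, y = F y • indParam Φ F (dirCoord Φ y) := by
    intro y hy
    have hp := hF.pos y (hVD hy)
    have h1 := inv_pos.2 (show 0 < (Φ y).1 from hy.1)
    rw [indParam, symm_dirCoord hy.1, hF.homogeneous y (hVD hy) _ h1, smul_smul, smul_smul]
    have hne := (show 0 < (Φ y).1 from hy.1).ne'
    rw [show F y * ((Φ y).1⁻¹ * F y)⁻¹ * (Φ y).1⁻¹ = 1 by field_simp, one_smul]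
  refine ⟨V, fun y => Ψ (dirCoord Φ y), hVopen, ?_, hVD, ?_, ?_, ?_, ?_⟩
  · simp [hV, hΦ, dirCoord, hδ]
  · intro y hy c hc
    refine ⟨?_, ?_⟩
    · have := hy.1
      simp only [mem_ofPred_eq, map_smul, Prod.smul_fst, smul_eq_mul] at this ⊢
      positivity
    · rw [mem_preimage, dirCoord_smul hc]
      exact hy.2
  · exact hΨ.comp (contDiffOn_dirCoord.mono inter_subset_left) fun y hy => hy.2
  · intro y c hc
    simp only [dirCoord_smul hc]
  · intro y hy
    have hyD := hVD hy
    set u := dirCoord Φ y with hu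
    have hub : u ∈ ball (0 : Vec n) δ := hy.2
    have hFy := hF.pos y hyD
    have hdu : HasFDerivAt (dirCoord Φ) (fderiv ℝ (dirCoord Φ) y) y :=
      (((contDiffOn_dirCoord (m := 1)).contDiffAt
        (isOpen_fst_pos.mem_nhds hy.1)).differentiableAt one_ne_zero).hasFDerivAt
    have hdΨ : HasFDerivAt Ψ (fderiv ℝ Ψ u) u :=
      ((hΨ.contDiffAt (isOpen_ball.mem_nhds hub)).differentiableAt (by simp)).hasFDerivAt
    have hdl : HasFDerivAt (indParam Φ F) (fderiv ℝ (indParam Φ F) u) u :=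
      (((contDiffOn_indParam hF hε).contDiffAt (isOpen_ball.mem_nhds (hsub hub))).differentiableAt
        (by simp)).hasFDerivAt
    have hdF := (hF.differentiableAt hs1 hyD).hasFDerivAt
    have hχ : ∀ v, fderiv ℝ (fun y => Ψ (dirCoord Φ y)) y v
        = fderiv ℝ Ψ u (fderiv ℝ (dirCoord Φ) y v) := fun v => by
      have h := (hdΨ.comp y hdu).fderiv
      exact congrArg (fun L => L v) h
    obtain ⟨hΨ1, hΨ2, hΨ3⟩ := hΨB u hub
    have hΨ2' : ∀ x, B (Ψ u) (fderiv ℝ Ψ u x) = 0 := by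
      intro x
      rw [fderiv_apply_eq_sum (fderiv ℝ Ψ u) x]
      simp [hΨ2]
    have hΨ3' : ∀ x z, B (fderiv ℝ Ψ u x) (fderiv ℝ Ψ u z)
        = C * metricForm F (indParam Φ F u) (fderiv ℝ (indParam Φ F) u x)
          (fderiv ℝ (indParam Φ F) u z) := by
      intro x z
      rw [← sum_indMetric hF hs2 hε (hsub hub), fderiv_apply_eq_sum (fderiv ℝ Ψ u) x,
        fderiv_apply_eq_sum (fderiv ℝ Ψ u) z]
      simp only [map_sum, map_smul, sum_apply, smul_apply, smul_eq_mul, hΨ3, Finset.mul_sum]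
      rw [Finset.sum_comm]
      refine Finset.sum_congr rfl fun a _ => Finset.sum_congr rfl fun b _ => ?_
      ring
    refine ⟨hΨ1, fun v => ?_, fun v w => ?_⟩
    · rw [hχ]
      exact hΨ2' _
    · rw [hχ, hχ, hΨ3']
      have hl := indParam_mem hF hε (hsub hub)
      set l := indParam Φ F u with hldef
      -- decomposition of a vector into its radial and tangential parts
      have hdec : ∀ v, v = fderiv ℝ F y v • l
          + F y • fderiv ℝ (indParam Φ F) u (fderiv ℝ (dirCoord Φ) y v) := by
        intro v
        have h1 := hdF.smul (hdl.comp y hdu)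
        have h2 : (fun z => z) =ᶠ[𝓝 y] fun z => F z • (indParam Φ F ∘ dirCoord Φ) z := by
          filter_upwards [hVopen.mem_nhds hy] with z hz using hrec z hz
        have h3 := (h1.congr_of_eventuallyEq h2).unique (hasFDerivAt_id y)
        have h4 := congrArg (fun L => L v) h3
        simp only [add_apply, smul_apply, ContinuousLinearMap.smulRight_apply,
          ContinuousLinearMap.comp_apply, ContinuousLinearMap.id_apply, Function.comp_apply] at h4
        exact h4.symm.trans (add_comm _ _)
      -- The radial vector is normal to the indicatrix: Euler's identity makes g(l, ·) equal to F
      -- dF, and F is constant along the parametrization.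
      have hll : ∀ x, metricForm F l l (fderiv ℝ (indParam Φ F) u x) = 0 := by
        intro x
        rw [hF.metricForm_self hs2 hl.1]
        have h1 := (hF.differentiableAt hs1 hl.1).hasFDerivAt.comp u hdl
        have h2 : (fun _ => (1 : ℝ)) =ᶠ[𝓝 u] F ∘ indParam Φ F := by
          filter_upwards [isOpen_ball.mem_nhds (hsub hub)] with z hz
          exact (indParam_mem hF hε hz).2.symm
        have h3 := (h1.congr_of_eventuallyEq h2).unique (hasFDerivAt_const (1 : ℝ) u)
        have h4 : fderiv ℝ F l (fderiv ℝ (indParam Φ F) u x) = 0 := congrArg (fun L => L x) h3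
        rw [h4, mul_zero]
      have hlself : metricForm F l l l = 1 := by
        have hFl : fderiv ℝ F l l = 1 := by
          have hγ : HasDerivAt (fun c : ℝ => c • l) l 1 := by
            simpa using (hasDerivAt_id (1 : ℝ)).smul_const l
          have h1 := HasFDerivAt.comp_hasDerivAt_of_eq (f := fun c : ℝ => c • l) (1 : ℝ)
            (hF.differentiableAt hs1 hl.1).hasFDerivAt hγ (by simp)
          have h2 : (fun c : ℝ => c) =ᶠ[𝓝 1] F ∘ fun c : ℝ => c • l := by
            filter_upwards [lt_mem_nhds (zero_lt_one' ℝ)] with c hc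
            simp [hF.homogeneous l hl.1 c hc, hl.2]
          exact (h1.congr_of_eventuallyEq h2).unique (hasDerivAt_id 1)
        rw [hF.metricForm_self hs2 hl.1, hFl, hl.2, one_mul]
      have hyl : metricForm F y = metricForm F l := by
        rw [hrec y hy]
        exact hF.metricForm_smul hs2 hl.1 hFy
      have hll' : ∀ x, metricForm F l (fderiv ℝ (indParam Φ F) u x) l = 0 := fun x => by
        rw [hF.metricForm_symm hs2 hl.1, hll]
      rw [hyl]
      conv_lhs => rw [hdec v, hdec w]
      simp only [map_add, map_smul, add_apply, smul_apply, smul_eq_mul, hll, hll', hlself]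
      ring

end ConeMap

/-! ### Flatness of Euclidean metrics pulled back by immersions. -/

section Pullback

open Set Metric Filter Topology

variable {N : ℕ}

/-- The partial derivative of a vector-valued map. -/
def vpd {W : Type*} [NormedAddCommGroup W] [NormedSpace ℝ W] (f : Vec N → W) (i : Fin N)
    (y : Vec N) : W :=
  fderiv ℝ f y (EuclideanSpace.single i 1)

variable {W : Type*} [NormedAddCommGroup W] [NormedSpace ℝ W] {V : Set (Vec N)}

theorem contDiffOn_vpd {f : Vec N → W} (hV : IsOpen V) {m k : WithTop ℕ∞}
    (hf : ContDiffOn ℝ k f V) (hm : m + 1 ≤ k) (i : Fin N) : ContDiffOn ℝ m (vpd f i) V :=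
  (hf.fderiv_of_isOpen hV hm).clm_apply contDiffOn_const

theorem vpd_comm {f : Vec N → W} (hV : IsOpen V) (hf : ContDiffOn ℝ 2 f V) {y : Vec N}
    (hy : y ∈ V) (i j : Fin N) : vpd (vpd f i) j y = vpd (vpd f j) i y := by
  have hd : DifferentiableAt ℝ (fderiv ℝ f) y :=
    ((hf.fderiv_of_isOpen hV (m := 1) (by rw [one_add_one_eq_two])).contDiffAt
      (hV.mem_nhds hy)).differentiableAt one_ne_zero
  have h : ∀ i j, vpd (vpd f i) j y
      = fderiv ℝ (fderiv ℝ f) y (EuclideanSpace.single j 1) (EuclideanSpace.single i 1) := by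
    intro i j
    have := (hd.hasFDerivAt.clm_apply (hasFDerivAt_const (EuclideanSpace.single i (1 : ℝ)) y)).fderiv
    change fderiv ℝ (fun z => fderiv ℝ f z (EuclideanSpace.single i (1 : ℝ))) y
      (EuclideanSpace.single j 1) = _
    rw [this]
    simp
  rw [h, h]
  exact (hf.contDiffAt (hV.mem_nhds hy)).isSymmSndFDerivAt (by simp) _ _

/-- The pull-back of a Euclidean metric by an immersion of class `C³` between spaces of the same
dimension is flat. -/
theorem curvature_pullback_eq_zero {k : Vec N → Matrix (Fin N) (Fin N) ℝ} {ξ : Vec N → Vec N}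
    (hV : IsOpen V) (hξ : ContDiffOn ℝ 3 ξ V)
    (B : Vec N →L[ℝ] Vec N →L[ℝ] ℝ) (hB : ∀ v w, B v w = B w v) (hBpos : ∀ v, v ≠ 0 → 0 < B v v)
    (hinj : ∀ y ∈ V, Function.Injective (fderiv ℝ ξ y))
    (hk : ∀ y ∈ V, ∀ i j, k y i j = B (vpd ξ i y) (vpd ξ j y))
    {y : Vec N} (hy : y ∈ V) (i a m j : Fin N) : curvature k y i a m j = 0 := by
  have hξ1 : ∀ i, ContDiffOn ℝ 2 (vpd ξ i) V := fun i =>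
    contDiffOn_vpd hV hξ (by rw [two_add_one_eq_three]) i
  have hkC : ∀ i j, ContDiffOn ℝ 2 (fun y => k y i j) V := fun i j =>
    ContDiffOn.congr ((contDiffOn_const (c := B)).clm_apply (hξ1 i) |>.clm_apply (hξ1 j))
      fun y hy => hk y hy i j
  have hcomb : ∀ z (v : Fin N → ℝ), ∑ c, v c • vpd ξ c z = fderiv ℝ ξ z (WithLp.toLp 2 v) := by
    intro z v
    rw [fderiv_apply_eq_sum (fderiv ℝ ξ z)]
    rfl
  have hpos : ∀ z ∈ V, (k z).PosDef := by
    intro z hz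
    refine Matrix.PosDef.of_dotProduct_mulVec_pos ?_ fun v hv => ?_
    · ext a b
      simp [hk z hz, hB (vpd ξ a z)]
    · have h0 : fderiv ℝ ξ z (WithLp.toLp 2 v) ≠ 0 := fun h0 =>
        hv (congrArg WithLp.ofLp (hinj z hz (h0.trans (map_zero _).symm)))
      have h1 := hBpos _ h0
      rw [← hcomb] at h1
      simp only [map_sum, map_smul, sum_apply, smul_apply, smul_eq_mul, Finset.mul_sum] at h1
      rw [Finset.sum_comm] at h1
      simp only [dotProduct, Matrix.mulVec, Finset.mul_sum, star_trivial, Pi.star_apply, hk z hz]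
      refine h1.trans_eq (Finset.sum_congr rfl fun p _ => Finset.sum_congr rfl fun q _ => ?_)
      ring
  have hdet : ∀ z ∈ V, IsUnit (k z).det := fun z hz => (hpos z hz).det_pos.ne'.isUnit
  have hΓ : ∀ c a b, ContDiffOn ℝ 1 (christoffel k c a b) V := fun c a b =>
    contDiffOn_christoffel hV hkC (by rw [one_add_one_eq_two]) hdet c a b
  have hd1 : ∀ z ∈ V, ∀ a, HasFDerivAt (vpd ξ a) (fderiv ℝ (vpd ξ a) z) z := fun z hz a =>
    (((hξ1 a).contDiffAt (hV.mem_nhds hz)).differentiableAt two_ne_zero).hasFDerivAt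
  have hpdk : ∀ z ∈ V, ∀ a b e, pd (fun y => k y a b) e z
      = B (vpd (vpd ξ a) e z) (vpd ξ b z) + B (vpd ξ a z) (vpd (vpd ξ b) e z) := by
    intro z hz a b e
    have h1 := B.hasFDerivAt_of_bilinear (hd1 z hz a) (hd1 z hz b)
    have h2 : (fun y => k y a b) =ᶠ[𝓝 z] fun y => B (vpd ξ a y) (vpd ξ b y) := by
      filter_upwards [hV.mem_nhds hz] with y hy using hk y hy a b
    rw [pd, h2.fderiv_eq, h1.fderiv]
    simp [ContinuousLinearMap.precompR_apply, vpd, add_comm]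
  -- the Gauss formula
  have hGauss : ∀ z ∈ V, ∀ a b, vpd (vpd ξ a) b z = ∑ c, christoffel k c a b z • vpd ξ c z := by
    intro z hz a b
    -- The difference of the two sides is orthogonal to every partial derivative of `ξ`. These span
    -- the space, the dimensions being equal, so positivity of `B` forces it to vanish.
    set w := ∑ c, christoffel k c a b z • vpd ξ c z - vpd (vpd ξ a) b z with hw
    have horth : ∀ d, B (vpd ξ d z) w = 0 := by
      intro d
      have hs2 : ContDiffOn ℝ 2 ξ V := hξ.of_le (by norm_num)
      have h1 := sum_mul_christoffel (hdet z hz) d a b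
      have hsym : ∀ a b, vpd (vpd ξ a) b z = vpd (vpd ξ b) a z := vpd_comm hV hs2 hz
      rw [hpdk z hz, hpdk z hz, hpdk z hz, hsym d a, hsym b a, hsym d b,
        hB (vpd (vpd ξ b) d z)] at h1
      simp only [hk z hz] at h1
      simp only [hw, map_sub, map_sum, map_smul, smul_eq_mul]
      have h2 : ∑ c, christoffel k c a b z * B (vpd ξ d z) (vpd ξ c z)
          = ∑ c, B (vpd ξ d z) (vpd ξ c z) * christoffel k c a b z :=
        Finset.sum_congr rfl fun c _ => mul_comm _ _
      rw [h2, h1]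
      ring
    obtain ⟨v, hv⟩ := (LinearMap.injective_iff_surjective
      (f := (fderiv ℝ ξ z : Vec N →ₗ[ℝ] Vec N))).1 (hinj z hz) w
    have hww : B w w = 0 := by
      have h1 : w = ∑ d, v d • vpd ξ d z := by
        rw [← hv]
        exact fderiv_apply_eq_sum (fderiv ℝ ξ z) v
      conv_lhs => enter [1]; rw [h1]
      simp [horth]
    have : w = 0 := by
      by_contra h
      exact (hBpos w h).ne' hww
    exact (sub_eq_zero.1 this).symm
  have hthird : ∀ a b e, vpd (vpd (vpd ξ a) b) e y
      = ∑ c, (pd (christoffel k c a b) e y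
        + ∑ t, christoffel k t a b y * christoffel k c t e y) • vpd ξ c y := by
    intro a b e
    have h1 : HasFDerivAt (fun z => ∑ c, christoffel k c a b z • vpd ξ c z)
        (∑ c, (christoffel k c a b y • fderiv ℝ (vpd ξ c) y
          + (fderiv ℝ (christoffel k c a b) y).smulRight (vpd ξ c y))) y :=
      HasFDerivAt.fun_sum fun c _ => HasFDerivAt.fun_smul
        (((hΓ c a b).contDiffAt (hV.mem_nhds hy)).differentiableAt one_ne_zero).hasFDerivAt
        (hd1 y hy c)
    have h2 : vpd (vpd ξ a) b =ᶠ[𝓝 y] fun z => ∑ c, christoffel k c a b z • vpd ξ c z := by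
      filter_upwards [hV.mem_nhds hy] with z hz using hGauss z hz a b
    have h3 : ∀ c, fderiv ℝ (vpd ξ c) y (EuclideanSpace.single e 1)
        = ∑ t, christoffel k t c e y • vpd ξ t y := fun c => hGauss y hy c e
    rw [vpd, h2.fderiv_eq, h1.fderiv]
    simp only [sum_apply, add_apply, smul_apply, ContinuousLinearMap.smulRight_apply, h3,
      Finset.sum_add_distrib, add_smul, Finset.smul_sum, Finset.sum_smul, smul_smul]
    rw [add_comm, Finset.sum_comm]
    rfl
  -- The curvature components are the coefficients of the commutator of third derivatives of `ξ`,
  -- which vanishes because `ξ` is C³.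
  have hcurv : ∑ c, curvature k y i c m j • vpd ξ c y = 0 := by
    have h1 := vpd_comm hV (hξ1 i) hy j m
    rw [hthird, hthird, ← sub_eq_zero, ← Finset.sum_sub_distrib] at h1
    rw [← h1]
    refine Finset.sum_congr rfl fun c _ => ?_
    rw [← sub_smul]
    congr 1
    simp only [curvature, Finset.sum_sub_distrib]
    ring
  rw [hcomb] at hcurv
  have := hinj y hy (hcurv.trans (map_zero _).symm)
  exact congrFun (congrArg WithLp.ofLp this) a

end Pullback

/-! ### The conformal maps F^κ χ and the two conclusions. -/

section Conformal

open Set Metric Filter Topology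

/-- The map `y ↦ F^κ χ(y)`. -/
def powMap {N : ℕ} (F : Vec N → ℝ) (χ : Vec N → Vec N) (κ : ℝ) (y : Vec N) : Vec N :=
  F y ^ κ • χ y

theorem contDiffOn_powMap {N : ℕ} {s r : WithTop ℕ∞} {D V : Set (Vec N)} {F : Vec N → ℝ}
    {χ : Vec N → Vec N} (hF : IsFinslerMetricFunction s D F) (hrs : r ≤ s) (hVD : V ⊆ D)
    (hχ : ContDiffOn ℝ r χ V) (κ : ℝ) : ContDiffOn ℝ r (powMap F χ κ) V :=
  (((hF.contDiffOn.mono hVD).of_le hrs).rpow_const_of_ne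
    fun y hy => (hF.pos y (hVD hy)).ne').smul hχ

/-- If `g = dF² + (F² / κ²) χ^* B` with `χ` in the unit sphere of `B`, then
`y ↦ F^κ χ(y)` is conformal. -/
theorem metricForm_eq_powMap {N : ℕ} {F : Vec N → ℝ} {χ : Vec N → Vec N} {y : Vec N} {C κ : ℝ}
    (hκ : κ ^ 2 = C) (hC : 0 < C) (hFy : 0 < F y) (hdF : DifferentiableAt ℝ F y)
    (hdχ : DifferentiableAt ℝ χ y)
    (B : Vec N →L[ℝ] Vec N →L[ℝ] ℝ) (hB : ∀ v w, B v w = B w v)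
    (h1 : B (χ y) (χ y) = 1) (h2 : ∀ v, B (χ y) (fderiv ℝ χ y v) = 0)
    (h3 : ∀ v w, C * metricForm F y v w = C * (fderiv ℝ F y v * fderiv ℝ F y w)
          + F y ^ 2 * B (fderiv ℝ χ y v) (fderiv ℝ χ y w)) (v w : Vec N) :
    metricForm F y v w = ((1 / κ) * F y ^ (1 - κ)) ^ 2 *
      B (fderiv ℝ (powMap F χ κ) y v) (fderiv ℝ (powMap F χ κ) y w) := by
  have hκ0 : κ ≠ 0 := by
    rintro rfl
    simp at hκ
    exact hC.ne hκ
  have hd : ∀ v, fderiv ℝ (powMap F χ κ) y v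
      = F y ^ κ • fderiv ℝ χ y v + (κ * F y ^ (κ - 1) * fderiv ℝ F y v) • χ y := by
    intro v
    have h := ((hdF.hasFDerivAt.rpow_const (p := κ) (Or.inl hFy.ne')).fun_smul
      hdχ.hasFDerivAt).fderiv
    have := congrArg (fun L => L v) h
    exact this
  set t := F y ^ (κ - 1) with ht
  have ht0 : 0 < t := Real.rpow_pos_of_pos hFy _
  have e1 : F y ^ κ = t * F y := by
    rw [ht, Real.rpow_sub_one hFy.ne', div_mul_cancel₀ _ hFy.ne']
  have e2 : F y ^ (1 - κ) = t⁻¹ := by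
    rw [ht, ← Real.rpow_neg hFy.le]
    congr 1
    ring
  -- Orthogonality of χ and dχ removes the mixed terms: for ζ = F^κ χ, B(dζ, dζ) = t² (κ² dF² + F²
  -- B(dχ, dχ)).
  have h2' : ∀ v, B (fderiv ℝ χ y v) (χ y) = 0 := fun v => by rw [hB, h2]
  rw [hd, hd, e1, e2]
  simp only [map_add, map_smul, add_apply, smul_apply, smul_eq_mul, h1, h2, h2']
  have h4 := h3 v w
  rw [← hκ] at h4
  field_simp
  linear_combination h4

variable {n : ℕ} {m : ℕ∞} {D : Set (Vec (n + 1))} {F : Vec (n + 1) → ℝ}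

theorem two_le_coe_add_three : (2 : WithTop ℕ∞) ≤ ((m + 3 : ℕ∞) : WithTop ℕ∞) := by
  have : (2 : ℕ∞) ≤ m + 3 := le_add_left (by norm_num)
  change ((2 : ℕ∞) : WithTop ℕ∞) ≤ _
  exact_mod_cast this

/-- The conformal map `F^κ χ` around a given direction, for every root `κ` of `κ² = C`. -/
theorem exists_powMap (hm : 1 ≤ m)
    (hF : IsFinslerMetricFunction ((m + 3 : ℕ∞) : WithTop ℕ∞) D F) {C : ℝ} (hC : 0 < C)
    (hcurv : IndicatrixHasConstantCurvature (n := n + 1) ((m + 3 : ℕ∞) : WithTop ℕ∞) D F C)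
    (B : Vec (n + 1) →L[ℝ] Vec (n + 1) →L[ℝ] ℝ) (hB : ∀ v w, B v w = B w v)
    (hBpos : ∀ v, v ≠ 0 → 0 < B v v) {y₀ : Vec (n + 1)} (hy₀ : y₀ ∈ D) {κ : ℝ} (hκ : κ ^ 2 = C) :
    ∃ (V : Set (Vec (n + 1))) (ζ : Vec (n + 1) → Vec (n + 1)), IsOpen V ∧ y₀ ∈ V ∧ V ⊆ D ∧
      (∀ y ∈ V, ∀ c : ℝ, 0 < c → c • y ∈ V) ∧
      ContDiffOn ℝ ((m + 2 : ℕ∞) : WithTop ℕ∞) ζ V ∧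
      (∀ y ∈ V, ∀ c : ℝ, 0 < c → ζ (c • y) = c ^ κ • ζ y) ∧
      (∀ y ∈ V, B (ζ y) (ζ y) = (F y ^ κ) ^ 2) ∧
      (∀ y ∈ V, ∀ v w, metricForm F y v w = ((1 / κ) * F y ^ (1 - κ)) ^ 2 *
        B (fderiv ℝ ζ y v) (fderiv ℝ ζ y w)) ∧
      ∀ y ∈ V, Function.Injective (fderiv ℝ ζ y) := by
  obtain ⟨V, χ, hV, hy₀V, hVD, hcone, hχ, hhom, h⟩ := exists_cone_map hm hF hC hcurv B hB hBpos hy₀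
  have hs2 := two_le_coe_add_three (m := m)
  have hconf : ∀ y ∈ V, ∀ v w, metricForm F y v w = ((1 / κ) * F y ^ (1 - κ)) ^ 2 *
        B (fderiv ℝ (powMap F χ κ) y v) (fderiv ℝ (powMap F χ κ) y w) := by
    intro y hy
    obtain ⟨h1, h2, h3⟩ := h y hy
    exact metricForm_eq_powMap hκ hC (hF.pos y (hVD hy))
      (hF.differentiableAt (one_le_two.trans hs2) (hVD hy))
      ((hχ.contDiffAt (hV.mem_nhds hy)).differentiableAt (by simp)) B hB h1 h2 h3
  refine ⟨V, powMap F χ κ, hV, hy₀V, hVD, hcone, contDiffOn_powMap hF ?_ hVD hχ κ, ?_, ?_, hconf, ?_⟩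
  · have : m + 2 ≤ m + 3 := by gcongr; norm_num
    exact_mod_cast this
  · intro y hy c hc
    rw [powMap, powMap, hhom y c hc, hF.homogeneous y (hVD hy) c hc,
      Real.mul_rpow hc.le (hF.pos y (hVD hy)).le, smul_smul]
  · intro y hy
    simp only [powMap, map_smul, smul_apply, smul_eq_mul, (h y hy).1]
    ring
  · intro y hy
    rw [injective_iff_map_eq_zero]
    intro v hv
    by_contra hv0
    have := hF.metricForm_pos hs2 (hVD hy) hv0
    rw [hconf y hy v v, hv] at this
    simp at this

/-- The conformal transforms of the Finslerian metric tensor by the factors `c₁ F^c₂`,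
`(1 + c₂)² = C`, are flat. -/
theorem curvature_conformalTensor_eq_zero (hm : 1 ≤ m)
    (hF : IsFinslerMetricFunction ((m + 3 : ℕ∞) : WithTop ℕ∞) D F) {C : ℝ} (hC : 0 < C)
    (hcurv : IndicatrixHasConstantCurvature (n := n + 1) ((m + 3 : ℕ∞) : WithTop ℕ∞) D F C)
    {c₁ c₂ : ℝ} (hc₁ : 0 < c₁) (hc₂ : (1 + c₂) ^ 2 = C) {y : Vec (n + 1)} (hy : y ∈ D)
    (i k p j : Fin (n + 1)) : curvature (conformalTensor F c₁ c₂) y i k p j = 0 := by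
  -- Any Euclidean form can serve as the flat target, so the standard inner product is used; κ = 1 +
  -- c₂ may be negative.
  obtain ⟨V, ζ, hV, hyV, hVD, -, hζ, -, -, hconf, hinj⟩ := exists_powMap hm hF hC hcurv
    (innerSL ℝ : Vec (n + 1) →L[ℝ] Vec (n + 1) →L[ℝ] ℝ)
    (fun v w => real_inner_comm w v) (fun v hv => real_inner_self_pos.2 hv) hy hc₂
  set κ := 1 + c₂ with hκ
  have hκ0 : κ ≠ 0 := by
    intro h0
    rw [h0] at hc₂
    simp at hc₂
    exact hC.ne hc₂
  have hcκ : c₁ / κ ≠ 0 := div_ne_zero hc₁.ne' hκ0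
  have hd : ∀ z ∈ V, HasFDerivAt ζ (fderiv ℝ ζ z) z := fun z hz =>
    ((hζ.contDiffAt (hV.mem_nhds hz)).differentiableAt (by simp)).hasFDerivAt
  have hfd : ∀ z ∈ V, fderiv ℝ (fun z => (c₁ / κ) • ζ z) z = (c₁ / κ) • fderiv ℝ ζ z :=
    fun z hz => ((hd z hz).fun_const_smul _).fderiv
  have h3 : (3 : WithTop ℕ∞) ≤ ((m + 2 : ℕ∞) : WithTop ℕ∞) := by
    have : (3 : ℕ∞) ≤ m + 2 := by
      calc (3 : ℕ∞) = 1 + 2 := by norm_num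
        _ ≤ m + 2 := by gcongr
    change ((3 : ℕ∞) : WithTop ℕ∞) ≤ _
    exact_mod_cast this
  -- As 1 - κ = -c₂, the conformal identity reads κ² F^(2c₂) g = B(dζ, dζ); the factor c₁/κ turns
  -- this into the tensor c₁² F^(2c₂) g.
  refine curvature_pullback_eq_zero (ξ := fun z => (c₁ / κ) • ζ z) hV
    (contDiffOn_const.fun_smul (hζ.of_le h3))
    (innerSL ℝ : Vec (n + 1) →L[ℝ] Vec (n + 1) →L[ℝ] ℝ) (fun v w => real_inner_comm w v)
    (fun v hv => real_inner_self_pos.2 hv) ?_ ?_ hyV i k p j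
  · intro z hz
    rw [hfd z hz]
    exact (smul_right_injective _ hcκ).comp (hinj z hz)
  · intro z hz a b
    have hFz := hF.pos z (hVD hz)
    have ht := Real.rpow_pos_of_pos hFz c₂
    rw [conformalTensor, Matrix.smul_apply,
      hF.metricTensor_eq two_le_coe_add_three (hVD hz), hconf z hz, vpd, vpd, hfd z hz,
      show 1 - κ = -c₂ by rw [hκ]; ring, Real.rpow_neg hFz.le]
    simp only [smul_apply, map_smul, smul_eq_mul]
    field_simp

/-- A homogeneous local conformal diffeomorphism onto a Euclidean region. -/
theorem conformalProperty (hm : 1 ≤ m)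
    (hF : IsFinslerMetricFunction ((m + 3 : ℕ∞) : WithTop ℕ∞) D F) {C : ℝ} (hC : 0 < C)
    (hcurv : IndicatrixHasConstantCurvature (n := n + 1) ((m + 3 : ℕ∞) : WithTop ℕ∞) D F C)
    (B : Vec (n + 1) →L[ℝ] Vec (n + 1) →L[ℝ] ℝ) (hB : ∀ v w, B v w = B w v)
    (hBpos : ∀ v, v ≠ 0 → 0 < B v v) :
    ConformalProperty ((m + 2 : ℕ∞) : WithTop ℕ∞) D F B (Real.sqrt C) := by
  intro y₀ hy₀
  have hh : 0 < Real.sqrt C := Real.sqrt_pos.2 hC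
  obtain ⟨V, ζ, hV, hyV, hVD, hcone, hζ, hhom, hnorm, hconf, hinj⟩ :=
    exists_powMap hm hF hC hcurv B hB hBpos hy₀ (Real.sq_sqrt hC.le)
  set h := Real.sqrt C with hdef
  have hm2 : ((m + 2 : ℕ∞) : WithTop ℕ∞) ≠ 0 := by simp
  have hζat : ∀ y ∈ V, ContDiffAt ℝ ((m + 2 : ℕ∞) : WithTop ℕ∞) ζ y := fun y hy =>
    hζ.contDiffAt (hV.mem_nhds hy)
  have hequiv : ∀ y ∈ V, ∃ e : Vec (n + 1) ≃L[ℝ] Vec (n + 1),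
      HasFDerivAt ζ (e : Vec (n + 1) →L[ℝ] Vec (n + 1)) y := by
    intro y hy
    let e := (LinearEquiv.ofInjectiveEndo (fderiv ℝ ζ y : Vec (n + 1) →ₗ[ℝ] Vec (n + 1))
      (hinj y hy)).toContinuousLinearEquiv
    refine ⟨e, ?_⟩
    have : (e : Vec (n + 1) →L[ℝ] Vec (n + 1)) = fderiv ℝ ζ y := by
      ext1 v
      rfl
    rw [this]
    exact ((hζat y hy).differentiableAt hm2).hasFDerivAt
  obtain ⟨e₀, he₀⟩ := hequiv y₀ hyV
  let f₀ := (hζat y₀ hyV).toOpenPartialHomeomorph ζ he₀ hm2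
  have hf₀ : y₀ ∈ f₀.source := (hζat y₀ hyV).mem_toOpenPartialHomeomorph_source he₀ hm2
  have hf₀coe : ⇑f₀ = ζ := rfl
  -- The inverse function theorem alone yields no conical domain. `ν` moves a vector along its ray
  -- to the level F = F(y₀), and `S` collects the vectors of `V` whose normalization lies in the
  -- domain of the local inverse; hence it is a cone.
  set ν : Vec (n + 1) → Vec (n + 1) := fun y => (F y₀ / F y) • y with hν
  have hF0 := hF.pos y₀ hy₀
  set S : Set (Vec (n + 1)) := V ∩ ν ⁻¹' f₀.source with hS
  have hSopen : IsOpen S := by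
    refine ContinuousOn.isOpen_inter_preimage ?_ hV f₀.open_source
    exact (continuousOn_const.div (hF.contDiffOn.continuousOn.mono hVD)
      fun y hy => (hF.pos y (hVD hy)).ne').smul continuousOn_id
  have hyS : y₀ ∈ S := ⟨hyV, by
    rw [mem_preimage, hν]
    simpa [div_self hF0.ne'] using hf₀⟩
  have hpow : ∀ y ∈ V, ∀ z ∈ V, B (ζ y) (ζ y) = B (ζ z) (ζ z) → F y = F z := by
    intro y hy z hz hyz
    have h1 := hF.pos y (hVD hy)
    have h2 := hF.pos z (hVD hz)
    rw [hnorm y hy, hnorm z hz] at hyz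
    exact (Real.rpow_left_inj h1.le h2.le hh.ne').1
      ((pow_left_inj₀ (Real.rpow_nonneg h1.le _) (Real.rpow_nonneg h2.le _) two_ne_zero).1 hyz)
  -- The length of ζ determines F. Vectors with equal images are therefore normalized by the same
  -- factor, and by homogeneity their normalizations also have equal images, where the local inverse
  -- applies.
  have hinjS : InjOn ζ S := by
    intro y hy z hz hyz
    have hFyz := hpow y hy.1 z hz.1 (by rw [hyz])
    have hc : 0 < F y₀ / F y := div_pos hF0 (hF.pos y (hVD hy.1))
    have h1 : ν y = ν z := by
      refine f₀.injOn hy.2 hz.2 ?_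
      rw [hf₀coe]
      simp only [hν, ← hFyz]
      rw [hhom y hy.1 _ hc, hhom z hz.1 _ hc, hyz]
    simp only [hν, ← hFyz] at h1
    exact smul_right_injective _ hc.ne' h1
  let E := hinjS.toPartialEquiv ζ S
  -- Openness is a local matter, so the inverse function theorem at each point of `S` suffices.
  have hopen : IsOpenMap (S.domRestrict ζ) := by
    rw [isOpenMap_iff_nhds_le]
    intro x
    obtain ⟨e, he⟩ := hequiv x.1 x.2.1
    have h1 := ((hζat x.1 x.2.1).hasStrictFDerivAt' he hm2).map_nhds_eq_of_equiv
    have h2 : map (Subtype.val : S → Vec (n + 1)) (𝓝 x) = 𝓝 x.1 := by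
      rw [map_nhds_subtype_val, hSopen.nhdsWithin_eq x.2]
    rw [show S.domRestrict ζ = ζ ∘ (Subtype.val : S → Vec (n + 1)) from rfl, ← Filter.map_map, h2,
      h1]
    exact le_rfl
  let Z : OpenPartialHomeomorph (Vec (n + 1)) (Vec (n + 1)) :=
    OpenPartialHomeomorph.ofContinuousOpenRestrict E (hζ.continuousOn.mono inter_subset_left) hopen
      hSopen
  have hZ : ⇑Z = ζ := rfl
  have hZs : Z.source = S := rfl
  refine ⟨Z, hyS, ?_⟩
  refine ⟨fun y hy => hVD hy.1, ?_, ?_, ?_, ?_, ?_, ?_⟩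
  · intro y hy c hc
    refine ⟨hcone y hy.1 c hc, ?_⟩
    have hy2 : ν y ∈ f₀.source := hy.2
    have hFy := hF.pos y (hVD hy.1)
    have : ν (c • y) = ν y := by
      simp only [hν]
      rw [hF.homogeneous y (hVD hy.1) c hc, smul_smul]
      congr 1
      field_simp
    rw [mem_preimage, this]
    exact hy2
  · rw [hZ]
    exact hζ.mono inter_subset_left
  · intro z hz
    have hz' : Z.symm z ∈ S := Z.map_target hz
    obtain ⟨e, he⟩ := hequiv _ hz'.1
    exact (Z.contDiffAt_symm hz he (hζat _ hz'.1)).contDiffWithinAt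
  · intro y hy c hc
    exact hhom y hy.1 c hc
  · intro y hy p q
    rw [hF.metricTensor_eq two_le_coe_add_three (hVD hy.1), hZ]
    exact hconf y hy.1 _ _
  · intro y hy
    have hFy := hF.pos y (hVD hy.1)
    rw [hZ, hnorm y hy.1]
    constructor
    · intro h1
      simp [h1]
    · intro h1
      have h2 : F y ^ h = 1 := by
        have := Real.rpow_nonneg hFy.le h
        nlinarith
      have h3 : F y ^ h = 1 ^ h := by rw [h2, Real.one_rpow]
      exact (Real.rpow_left_inj hFy.le zero_le_one hh.ne').1 h3

end Conformal

end Finsleroid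

end

/-! ### The theorem at a point of the manifold. -/

theorem theorem2p4 {N : ℕ} {M : Type*} [TopologicalSpace M]
    [ChartedSpace (Finsleroid.Vec N) M] [IsManifold (𝓡 N) 1 M]
    (r : ℕ∞) (hr : 3 ≤ r)
    (S : Finsleroid.FinslerSpace N ((r + 1 : ℕ∞) : WithTop ℕ∞) M)
    (a : Bundle.RiemannianMetric (fun x : M => TangentSpace (𝓡 N) x))
    (x : M) (C : ℝ) (hC : 0 < C)
    (hconst : Finsleroid.IndicatrixHasConstantCurvature (n := N)
      ((r + 1 : ℕ∞) : WithTop ℕ∞) (S.dom x) (S.F x) C) :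
    (∀ c₁ c₂ : ℝ, 0 < c₁ → (1 + c₂) ^ 2 = C →
      ∀ y ∈ S.dom x, ∀ i k m j : Fin N,
        Finsleroid.curvature (Finsleroid.conformalTensor (n := N) (S.F x) c₁ c₂) y i k m j = 0) ∧
    Finsleroid.ConformalProperty (n := N) (r : WithTop ℕ∞) (S.dom x) (S.F x) (a.inner x)
      (Real.sqrt C) := by
  obtain ⟨m, hm, rfl⟩ : ∃ m : ℕ∞, 1 ≤ m ∧ r = m + 2 := by
    obtain ⟨c, rfl⟩ := le_iff_exists_add.1 hr
    refine ⟨1 + c, le_self_add, ?_⟩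
    rw [add_right_comm]
    rfl
  have e : m + 2 + 1 = m + 3 := by rw [add_assoc]; rfl
  have hF : Finsleroid.IsFinslerMetricFunction (n := N) ((m + 3 : ℕ∞) : WithTop ℕ∞) (S.dom x)
      (S.F x) := by
    rw [← e]
    exact S.isFinsler x
  have hconst' : Finsleroid.IndicatrixHasConstantCurvature (n := N) ((m + 3 : ℕ∞) : WithTop ℕ∞)
      (S.dom x) (S.F x) C := by
    rw [← e]
    exact hconst
  -- In dimension 0 the only vector is 0, which is not admissible, so nothing is to be proved.
  rcases N with _ | n
  · refine ⟨fun _ _ _ _ _ _ i => i.elim0, fun y hy => ?_⟩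
    have h0 : y = 0 := Subsingleton.elim _ _
    exact absurd (h0 ▸ hy) hF.zero_notMem
  · exact ⟨fun c₁ c₂ hc₁ hc₂ y hy i k p j =>
      Finsleroid.curvature_conformalTensor_eq_zero hm hF hC hconst' hc₁ hc₂ hy i k p j,
      Finsleroid.conformalProperty hm hF hC hconst' (a.inner x) (a.symm x) (a.pos x)⟩
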